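/- **Setting.** A Bayesian contextual bandit problem $\Phi$ consists of a prior $\mathbb P_\Theta$ on a parameter space $\mathcal O$, a context distribution $\mathbb P_X$ on $\mathcal X$, an action set $\mathcal A$, and a Markov kernel giving the law of the real reward $R(x,a,\theta)$ for context $x$, action $a$ and parameter $\theta$. Let $T$ be the number of rounds. The optimal cumulative reward is $R^\star_\Phi=\sup_\psi \mathbb E\big[\sum_{t=1}^T R(X_t,\psi(X_t,\Theta),\Theta)\big]$, where the supremum is over the measurable $\psi:\mathcal X\times\mathcal O\to\mathcal A$ for which this expectation is defined, the contexts $X_t\sim\mathbb P_X$ being independent of $\Theta\sim\mathbb P_\Theta$; assume that it is attained (and finite), and let $\psi^\star$ attain it. Thompson sampling (TS) proceeds as follows: given the history $\hat H^t=(\hat A_s,X_s,R_s)_{s<t}$, in round $t$ it observes a context $X_t\sim\mathbb P_X$ independent of $\Theta$ and the past, samples $\hat\Theta_t$ from the posterior $\mathbb P_{\Theta\mid\hat H^t}$, plays $\hat A_t=\psi^\star(X_t,\hat\Theta_t)$, and collects $R_t=R(X_t,\hat A_t,\Theta)$, assumed integrable. Let $\mathrm{REG}^{\mathrm{TS}}_\Phi=R^\star_\Phi-\mathbb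 E\big[\sum_{t=1}^T R_t\big]$ be its regret, and write $R_t^\star=R(X_t,\psi^\star(X_t,\Theta),\Theta)$ and $\mathbb E_t[\cdot]=\mathbb E[\cdot\mid\hat H^t,X_t]$. The lifted information ratio of round $t$ is $$\Gamma_t=\frac{\mathbb E_t[R_t^\star-R_t]^2}{\mathrm I_t(\Theta;R_t\mid\hat A_t)},\qquad \mathrm I_t(\Theta;R_t\mid\hat A_t)=\mathbb E_t\big[\mathrm D_{\mathrm{KL}}\big(\mathbb P_{R_t\mid\hat H^t,X_t,\hat A_t,\Theta}\,\|\,\mathbb P_{R_t\mid\hat H^t,X_t,\hat A_t}\big)\big],$$ with $0/0=0$ and $a/0=\infty$ for $a>0$. **Theorem.** Let $(\mathcal O,\rho)$ be a metric space and, for $\varepsilon>0$, let $|\mathcal N(\mathcal O,\rho,\varepsilon)|\in\{1,2,\dots\}\cup\{\infty\}$ be its $\varepsilon$-covering number, the smallest cardinality of a set $\mathcal N\subseteq\mathcal O$ such that every $\theta\in\mathcal O$ is at distance at most $\varepsilon$ from a point of $\mathcal N$. Assume that the reward kernel has densities $f_{R\mid X=x,A=a,\Theta=\theta}$, jointly measurable,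 with respect to a $\sigma$-finite measure on $\mathbb R$, and that there are nonnegative random variables $C_t$, each a measurable function of $(R_t,X_t,\hat A_t)$ only, such that for all $\theta,\theta'\in\mathcal O$ and all $t\le T$, almost surely, the log-likelihoods below are finite and $$\big|\log f_{R\mid X_t,\hat A_t,\Theta=\theta}(R_t)-\log f_{R\mid X_t,\hat A_t,\Theta=\theta'}(R_t)\big|\le C_t\,\rho(\theta,\theta').$$ Assume also that $\frac1T\sum_{t=1}^T\mathbb E[\Gamma_t]\le\Gamma$ for some real $\Gamma>0$. Then $$\mathrm{REG}^{\mathrm{TS}}_\Phi\le\sqrt{\Gamma\,T\,\inf_{\varepsilon>0}\big\{\varepsilon\,\mathbb E[C]\,T+\log|\mathcal N(\mathcal O,\rho,\varepsilon)|\big\}},$$ where $\mathbb E[C]=\frac1T\sum_{t=1}^T\mathbb E[C_t]\in[0,\infty]$ (the common value of $\mathbb E[C_t]$ if that does not depend on $t$). The rewards need not be binary. -/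

import Mathlib

open MeasureTheory ProbabilityTheory Finset
open scoped ENNReal NNReal

/-- A Bayesian contextual bandit problem with parameter space `O`, context space `X` and action
set `A`: a prior on the parameters, a context distribution, and a reward kernel giving the law of
the reward for each (context, action, parameter). -/
structure ContextualBandit (O X A : Type*) [MeasurableSpace O] [MeasurableSpace X]
    [MeasurableSpace A] where
  prior : Measure O
  context : Measure X
  reward : Kernel (X × A × O) ℝ
  isProbabilityMeasure_prior : IsProbabilityMeasure prior
  isProbabilityMeasure_context : IsProbabilityMeasure context
  isMarkovKernel_reward : IsMarkovKernel reward

namespace ContextualBandit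

variable {O X A : Type*} [MeasurableSpace O] [MeasurableSpace X] [MeasurableSpace A]

/-- The law of `R(X, ψ(X, Θ), Θ)`, the reward that the decision rule `ψ`, which knows the
parameter, collects in one round; here `X` and `Θ` are independent. -/
noncomputable def ruleRewardLaw (Φ : ContextualBandit O X A) (ψ : X × O → A) : Measure ℝ :=
  (Φ.context.prod Φ.prior).bind fun p => Φ.reward (p.1, ψ p, p.2)

/-- `ψ` is a (measurable) decision rule whose expected reward is defined. -/
def IsAdmissibleRule (Φ : ContextualBandit O X A) (ψ : X × O → A) : Prop :=
  Measurable ψ ∧ Integrable (fun r : ℝ => r) (Φ.ruleRewardLaw ψ)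

/-- `E[∑ₜ R(Xₜ, ψ(Xₜ, Θ), Θ)]`, the sum over `T` rounds. -/
noncomputable def ruleReward (Φ : ContextualBandit O X A) (T : ℕ) (ψ : X × O → A) : ℝ :=
  ∑ _t ∈ range T, ∫ r, r ∂(Φ.ruleRewardLaw ψ)

/-- The optimal cumulative reward: the supremum of the cumulative expected reward over the
decision rules. -/
noncomputable def optimalReward (Φ : ContextualBandit O X A) (T : ℕ) : ℝ :=
  sSup {v | ∃ ψ : X × O → A, Φ.IsAdmissibleRule ψ ∧ v = Φ.ruleReward T ψ}

/-- `ψ` is an optimal decision rule: it attains the supremum in `optimalReward`. -/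
def IsOptimalRule (Φ : ContextualBandit O X A) (T : ℕ) (ψ : X × O → A) : Prop :=
  Φ.IsAdmissibleRule ψ ∧
    ∀ ψ' : X × O → A, Φ.IsAdmissibleRule ψ' → Φ.ruleReward T ψ' ≤ Φ.ruleReward T ψ

/-- `f` is a likelihood of the rewards with respect to the reference measure `μ`:
`f (x, a, θ)` is the density of the reward given context `x`, action `a` and parameter `θ`. -/
def IsLikelihood (Φ : ContextualBandit O X A) (μ : Measure ℝ) (f : X × A × O → ℝ → ℝ) : Prop :=
  Measurable (fun p : (X × A × O) × ℝ => f p.1 p.2) ∧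
    ∀ z : X × A × O, Φ.reward z = μ.withDensity fun r => ENNReal.ofReal (f z r)

end ContextualBandit

/-- The possible values of the history collected in `t` rounds: (action, context, reward) for each
round. -/
abbrev History (X A : Type*) (t : ℕ) : Type _ := Fin t → A × X × ℝ

/-- The history collected before round `t` (rounds are numbered from `0`) when the action of round
`i` is `ψ(Xᵢ, Θ̂ᵢ)`. -/
def collectedHistory {Ω O X A : Type*} (ψ : X × O → A) (ctx : ℕ → Ω → X) (est : ℕ → Ω → O)
    (rew : ℕ → Ω → ℝ) (t : ℕ) (ω : Ω) : History X A t :=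
  fun i => (ψ (ctx i ω, est i ω), ctx i ω, rew i ω)

/-- A run of Thompson sampling for `T` rounds on the bandit problem `Φ`, with decision rule `ψ`, on
a probability space `(Ω, P)`. -/
structure ThompsonSampling {O X A Ω : Type*} [MeasurableSpace O] [MeasurableSpace X]
    [MeasurableSpace A] [MeasurableSpace Ω] (Φ : ContextualBandit O X A) (ψ : X × O → A) (T : ℕ)
    (P : Measure Ω) where
  /-- the true parameter `Θ` -/
  param : Ω → O
  /-- the contexts `Xₜ` -/
  ctx : ℕ → Ω → X
  /-- the sampled parameters `Θ̂ₜ` -/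
  est : ℕ → Ω → O
  /-- the collected rewards `Rₜ` -/
  rew : ℕ → Ω → ℝ
  /-- the rewards `Rₜ⋆ = R(Xₜ, ψ(Xₜ, Θ), Θ)` that the rule `ψ` would collect knowing `Θ` -/
  optRew : ℕ → Ω → ℝ
  /-- the posteriors: the conditional law of `Θ` given the history before round `t` -/
  posterior : (t : ℕ) → Kernel (History X A t) O
  measurable_rule : Measurable ψ
  measurable_param : Measurable param
  measurable_ctx : ∀ t, Measurable (ctx t)
  measurable_est : ∀ t, Measurable (est t)
  measurable_rew : ∀ t, Measurable (rew t)
  measurable_optRew : ∀ t, Measurable (optRew t)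
  isMarkovKernel_posterior : ∀ t, IsMarkovKernel (posterior t)
  /-- the parameter is drawn from the prior -/
  hasLaw_param : HasLaw param Φ.prior P
  /-- the context of round `t` is drawn from the context distribution, independently of the
  parameter and of the past -/
  hasCondDistrib_ctx : ∀ t < T, HasCondDistrib (ctx t)
    (fun ω => (param ω, collectedHistory ψ ctx est rew t ω)) (Kernel.const _ Φ.context) P
  /-- `posterior t` is the conditional law of `Θ` given the history -/
  hasCondDistrib_posterior : ∀ t < T,
    HasCondDistrib param (collectedHistory ψ ctx est rew t) (posterior t) P
  /-- `Θ̂ₜ` is drawn from the posterior given the history, independently of everything else -/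
  hasCondDistrib_est : ∀ t < T, HasCondDistrib (est t)
    (fun ω => (param ω, collectedHistory ψ ctx est rew t ω, ctx t ω))
    ((posterior t).comap (fun z : O × History X A t × X => z.2.1) (by fun_prop)) P
  /-- the reward of round `t` is drawn from the reward kernel at `(Xₜ, Âₜ, Θ)`,
  `Âₜ = ψ(Xₜ, Θ̂ₜ)` -/
  hasCondDistrib_rew : ∀ t < T, HasCondDistrib (rew t)
    (fun ω => (param ω, collectedHistory ψ ctx est rew t ω, ctx t ω, est t ω))
    (Φ.reward.comap (fun z : O × History X A t × X × O => (z.2.2.1, ψ z.2.2, z.1))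
      (by fun_prop)) P
  /-- the optimal reward of round `t` is drawn from the reward kernel at `(Xₜ, ψ(Xₜ, Θ), Θ)` -/
  hasCondDistrib_optRew : ∀ t < T, HasCondDistrib (optRew t)
    (fun ω => (param ω, collectedHistory ψ ctx est rew t ω, ctx t ω))
    (Φ.reward.comap (fun z : O × History X A t × X => (z.2.2, ψ (z.2.2, z.1), z.1))
      (by fun_prop)) P

namespace ThompsonSampling

variable {O X A Ω : Type*} [MeasurableSpace O] [MeasurableSpace X] [MeasurableSpace A]
  [MeasurableSpace Ω] {Φ : ContextualBandit O X A} {ψ : X × O → A} {T : ℕ} {P : Measure Ω}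

/-- The history `Ĥᵗ` before round `t`. -/
def hist (S : ThompsonSampling Φ ψ T P) (t : ℕ) : Ω → History X A t :=
  collectedHistory ψ S.ctx S.est S.rew t

/-- The action `Âₜ = ψ(Xₜ, Θ̂ₜ)`. -/
def act (S : ThompsonSampling Φ ψ T P) (t : ℕ) (ω : Ω) : A := ψ (S.ctx t ω, S.est t ω)

/-- The `σ`-algebra generated by `(Ĥᵗ, Xₜ)`; conditioning on it gives the operator `Eₜ`. -/
abbrev sigmaHistCtx (S : ThompsonSampling Φ ψ T P) (t : ℕ) : MeasurableSpace Ω :=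
  MeasurableSpace.comap (fun ω => (S.hist t ω, S.ctx t ω)) inferInstance

/-- The Bayesian expected regret of Thompson sampling. -/
noncomputable def regret (S : ThompsonSampling Φ ψ T P) : ℝ :=
  Φ.optimalReward T - ∫ ω, ∑ t ∈ range T, S.rew t ω ∂P

/-- The relative entropy of the conditional law of `Rₜ` given `(Ĥᵗ, Xₜ, Âₜ, Θ)` with respect to
the conditional law of `Rₜ` given `(Ĥᵗ, Xₜ, Âₜ)`, as a random variable. -/
noncomputable def rewardDivergence (S : ThompsonSampling Φ ψ T P) [IsFiniteMeasure P] (t : ℕ)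
    (ω : Ω) : ℝ≥0∞ :=
  InformationTheory.klDiv
    (condDistrib (S.rew t) (fun ω' => (S.hist t ω', S.ctx t ω', S.act t ω', S.param ω')) P
      (S.hist t ω, S.ctx t ω, S.act t ω, S.param ω))
    (condDistrib (S.rew t) (fun ω' => (S.hist t ω', S.ctx t ω', S.act t ω')) P
      (S.hist t ω, S.ctx t ω, S.act t ω))

/-- The disintegrated conditional mutual information `Iₜ(Θ; Rₜ | Âₜ)`. -/
noncomputable def condInfo (S : ThompsonSampling Φ ψ T P) [IsFiniteMeasure P] (t : ℕ) :
    Ω → ℝ≥0∞ :=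
  condLExp (S.sigmaHistCtx t) P (S.rewardDivergence t)

/-- The lifted information ratio `Γₜ = Eₜ[Rₜ⋆ - Rₜ]² / Iₜ(Θ; Rₜ | Âₜ)`, with `0 / 0 = 0` and
`a / 0 = ∞` for `a > 0`. -/
noncomputable def liftedInfoRatio (S : ThompsonSampling Φ ψ T P) [IsFiniteMeasure P] (t : ℕ)
    (ω : Ω) : ℝ≥0∞ :=
  ENNReal.ofReal ((condExp (S.sigmaHistCtx t) P (fun ω' => S.optRew t ω' - S.rew t ω') ω) ^ 2)
    / S.condInfo t ω

/-- The log-likelihood of the rewards is a Lipschitz process in the parameter, with (random)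
Lipschitz constant `Cₜ = C t (Rₜ, Xₜ, Âₜ)` in round `t`. The likelihoods have to be positive for
their logarithms to be defined. -/
def IsLipschitzLogLikelihood {O X A Ω : Type*} [MetricSpace O] [MeasurableSpace O]
    [MeasurableSpace X] [MeasurableSpace A] [MeasurableSpace Ω] {Φ : ContextualBandit O X A}
    {ψ : X × O → A} {T : ℕ} {P : Measure Ω} (S : ThompsonSampling Φ ψ T P)
    (f : X × A × O → ℝ → ℝ) (C : ℕ → ℝ × X × A → ℝ≥0) : Prop :=
  (∀ t < T, Measurable (C t)) ∧
  ∀ t < T, ∀ θ θ' : O, ∀ᵐ ω ∂P,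
    0 < f (S.ctx t ω, S.act t ω, θ) (S.rew t ω) ∧
    0 < f (S.ctx t ω, S.act t ω, θ') (S.rew t ω) ∧
    |Real.log (f (S.ctx t ω, S.act t ω, θ) (S.rew t ω)) -
        Real.log (f (S.ctx t ω, S.act t ω, θ') (S.rew t ω))| ≤
      C t (S.rew t ω, S.ctx t ω, S.act t ω) * dist θ θ'

/-- `E[C]`, the expectation of the Lipschitz constant `Cₜ = C t (Rₜ, Xₜ, Âₜ)`, averaged over the
`T` rounds (if `E[Cₜ]` is the same in all rounds, this is its common value). -/
noncomputable def meanLipschitzConst (S : ThompsonSampling Φ ψ T P)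
    (C : ℕ → ℝ × X × A → ℝ≥0) : ℝ≥0∞ :=
  (∑ t ∈ range T, ∫⁻ ω, (C t (S.rew t ω, S.ctx t ω, S.act t ω) : ℝ≥0∞) ∂P) / T

end ThompsonSampling

/-- `log N(O, ρ, ε)`, the logarithm of the `ε`-covering number of a metric space (`∞` if there is
no finite `ε`-net). -/
noncomputable def logCoveringNumber (O : Type*) [MetricSpace O] (ε : ℝ≥0) : ℝ≥0∞ :=
  (ENNReal.log (Metric.coveringNumber ε (Set.univ : Set O) : ℝ≥0∞)).toENNReal

/-! Two estimates combine. First, the definition of the lifted ratio gives `|Eₜ[Rₜ⋆ - Rₜ]| ≤ √(Γₜ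
Iₜ)`; Cauchy–Schwarz in `ω` and again over the rounds bounds the regret by the square root of the
total expected ratio times the total expected information (`ofReal_regret_le`). By the tower
property the latter is the sum of the expected values of `rewardDivergence`.

Second, this sum is bounded by prediction with log loss. The law of the reward given `(Ĥᵗ, Xₜ, Âₜ)`
is the posterior mixture of the densities, and the mixture minimizes the averaged divergence. So any
sub-probability density `q` depending on the same data, and nonzero at the observed reward, can
replace it at the cost of an upper bound: the mean of `log f_Θ(Rₜ) - log q(Rₜ)`, when this is
integrable (`lintegral_klDiv_condDistrib_le`). Take for `q` the Bayesian prediction under the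
uniform prior on a finite `ε`-net `N`. It is a ratio of consecutive total likelihoods `Λₜ₊₁ / Λₜ`,
so the logarithms telescope to `log Λ_T - log #N`, and `Λ_T` is at least the likelihood of the net
point near `Θ`. The Lipschitz bound compares that point with `Θ` at cost `ε ∑ Cₜ`
(`sum_lintegral_rewardDivergence_le`).

One measure-theoretic gap remains: the Lipschitz bound is almost sure for each fixed pair of
parameters, with an exceptional set depending on the pair, yet it is applied at the random `Θ`. It
transfers because the joint law of `Θ` and the observations is absolutely continuous with respect to
the product of the prior and the law of the observations (`absolutelyContinuous_round`). -/

namespace InformationTheory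

/-! ### Divergences of measures with densities. -/

/-- The integrand `q * klFun (p / q)` of the Kullback-Leibler divergence of two measures with
densities `p` and `q`. -/
noncomputable def klIntegrand (p q : ℝ≥0∞) : ℝ≥0∞ :=
  q * ENNReal.ofReal (klFun (p / q).toReal)

lemma measurable_klIntegrand : Measurable fun x : ℝ≥0∞ × ℝ≥0∞ => klIntegrand x.1 x.2 := by
  unfold klIntegrand
  have := measurable_klFun
  fun_prop

lemma _root_.Measurable.klIntegrand {α : Type*} [MeasurableSpace α] {p q : α → ℝ≥0∞}
    (hp : Measurable p) (hq : Measurable q) : Measurable fun a => klIntegrand (p a) (q a) :=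
  measurable_klIntegrand.comp (hp.prodMk hq)

lemma klIntegrand_zero_right (p : ℝ≥0∞) : klIntegrand p 0 = 0 := by simp [klIntegrand]

lemma klIntegrand_eq_ofReal {p q : ℝ≥0∞} (hq0 : q ≠ 0) (hq : q ≠ ∞) :
    klIntegrand p q = ENNReal.ofReal (p.toReal * Real.log p.toReal - p.toReal * Real.log q.toReal
      + q.toReal - p.toReal) := by
  have hq' : 0 < q.toReal := ENNReal.toReal_pos hq0 hq
  rw [klIntegrand, ← ENNReal.ofReal_toReal hq, ← ENNReal.ofReal_mul hq'.le,
    ENNReal.ofReal_toReal hq, klFun_apply, ENNReal.toReal_div]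
  congr 1
  rcases eq_or_ne p.toReal 0 with h | h
  · simp [h]
  · rw [Real.log_div h hq'.ne']
    field_simp

lemma mul_log_sub_nonneg {p q : ℝ} (hp : 0 ≤ p) (hq : 0 < q) :
    0 ≤ p * Real.log p - p * Real.log q + q - p := by
  have h := klFun_nonneg (div_nonneg hp hq.le)
  rcases hp.eq_or_lt with rfl | hp
  · simpa using hq.le
  · rw [klFun_apply, Real.log_div hp.ne' hq.ne'] at h
    have := mul_nonneg hq.le h
    field_simp at this
    linarith

/-- By `h0` the measure with density `p` has density `p / q` relative to the one with density `q`,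
and integrating `klFun` of this ratio against `q` gives the integrand. -/
lemma klDiv_withDensity {α : Type*} [MeasurableSpace α] {μ : Measure α} [SigmaFinite μ]
    {p q : α → ℝ≥0∞} (hp : Measurable p) (hq : Measurable q) (hpi : ∫⁻ a, p a ∂μ ≠ ∞)
    (hqi : ∫⁻ a, q a ∂μ ≠ ∞) (h0 : ∀ᵐ a ∂μ, q a = 0 → p a = 0) :
    klDiv (μ.withDensity p) (μ.withDensity q) = ∫⁻ a, klIntegrand (p a) (q a) ∂μ := by
  have := isFiniteMeasure_withDensity hpi
  have := isFiniteMeasure_withDensity hqi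
  have hpq : μ.withDensity p = (μ.withDensity q).withDensity (fun a => p a / q a) := by
    change _ = (μ.withDensity q).withDensity (p / q)
    rw [← withDensity_mul _ hq (hp.div hq)]
    refine withDensity_congr_ae ?_
    filter_upwards [h0, ae_lt_top hq hqi] with a ha ha'
    simp only [Pi.mul_apply, Pi.div_apply]
    rcases eq_or_ne (q a) 0 with h | h
    · simp [h, ha h]
    · rw [ENNReal.mul_div_cancel h ha'.ne]
  have hac : μ.withDensity p ≪ μ.withDensity q := by
    rw [hpq]; exact withDensity_absolutelyContinuous _ _
  have hrn : (μ.withDensity p).rnDeriv (μ.withDensity q) =ᵐ[μ.withDensity q]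
      fun a => p a / q a := by
    conv_lhs => rw [hpq]
    exact Measure.rnDeriv_withDensity _ (hp.div hq)
  have hm := measurable_klFun
  rw [klDiv_eq_lintegral_klFun_of_ac hac]
  rw [lintegral_congr_ae (g := fun a => ENNReal.ofReal (klFun (p a / q a).toReal))
    (by filter_upwards [hrn] with a ha; rw [ha])]
  rw [lintegral_withDensity_eq_lintegral_mul _ hq (by fun_prop)]
  rfl

/-- Replacing the mixture of densities by another density increases the averaged integrand. -/
lemma lintegral_klIntegrand_mixture_le {α : Type*} [MeasurableSpace α] {π : Measure α}
    [IsProbabilityMeasure π] {p : α → ℝ≥0∞} (hp : Measurable p) {q : ℝ≥0∞} (hq : q ≠ ∞)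
    (hm : ∫⁻ a, p a ∂π ≠ ∞) (h0 : q = 0 → ∫⁻ a, p a ∂π = 0) :
    ∫⁻ a, klIntegrand (p a) (∫⁻ b, p b ∂π) ∂π ≤ ∫⁻ a, klIntegrand (p a) q ∂π := by
  set m := ∫⁻ b, p b ∂π with hmdef
  rcases eq_or_ne m 0 with hm0 | hm0
  · simp [hm0, klIntegrand_zero_right]
  have hq0 : q ≠ 0 := fun h => hm0 (h0 h)
  set c := Real.log m.toReal - Real.log q.toReal with hc
  have hpos := mul_log_sub_nonneg (p := m.toReal) ENNReal.toReal_nonneg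
    (ENNReal.toReal_pos hq0 hq)
  -- The compensation identity `kl(p, q) + m = kl(p, m) + p c + q`, with `c = log (m / q)`. Its
  -- linear term is split into positive and negative parts, so that no subtraction in `ℝ≥0∞` occurs.
  have hpt : ∀ᵐ a ∂π, klIntegrand (p a) q + (p a * ENNReal.ofReal (-c) + m) =
      klIntegrand (p a) m + (p a * ENNReal.ofReal c + q) := by
    filter_upwards [ae_lt_top hp hm] with a ha
    have e1 := mul_log_sub_nonneg (p := (p a).toReal) ENNReal.toReal_nonneg
      (ENNReal.toReal_pos hq0 hq)
    have e2 := mul_log_sub_nonneg (p := (p a).toReal) ENNReal.toReal_nonneg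
      (ENNReal.toReal_pos hm0 hm)
    rw [klIntegrand_eq_ofReal hq0 hq, klIntegrand_eq_ofReal hm0 hm]
    have hpa : p a = ENNReal.ofReal (p a).toReal := (ENNReal.ofReal_toReal ha.ne).symm
    have hma : m = ENNReal.ofReal m.toReal := (ENNReal.ofReal_toReal hm).symm
    have hqa : q = ENNReal.ofReal q.toReal := (ENNReal.ofReal_toReal hq).symm
    have hp0 : 0 ≤ (p a).toReal := ENNReal.toReal_nonneg
    have hm0' : 0 ≤ m.toReal := ENNReal.toReal_nonneg
    have hq0' : 0 ≤ q.toReal := ENNReal.toReal_nonneg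
    generalize (p a).toReal = x at *
    generalize m.toReal = y at *
    generalize q.toReal = w at *
    rw [hpa, hma, hqa, ← ENNReal.ofReal_mul hp0, ← ENNReal.ofReal_mul hp0]
    rcases le_total 0 c with h | h
    · have : ENNReal.ofReal (x * -c) = 0 := ENNReal.ofReal_of_nonpos (by nlinarith)
      rw [this, zero_add, ← ENNReal.ofReal_add e1 hm0',
        ← ENNReal.ofReal_add (by positivity) hq0', ← ENNReal.ofReal_add e2 (by positivity)]
      congr 1
      rw [hc]; ring
    · have : ENNReal.ofReal (x * c) = 0 := ENNReal.ofReal_of_nonpos (by nlinarith)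
      have h' : 0 ≤ -c := by linarith
      rw [this, zero_add, ← ENNReal.ofReal_add (by positivity) hm0',
        ← ENNReal.ofReal_add e1 (by positivity), ← ENNReal.ofReal_add e2 hq0']
      congr 1
      rw [hc]; ring
  have hint := lintegral_congr_ae hpt
  rw [lintegral_add_right _ (by fun_prop), lintegral_add_right _ (by fun_prop),
    lintegral_add_right _ (by fun_prop), lintegral_add_right _ (by fun_prop),
    lintegral_mul_const _ hp, lintegral_mul_const _ hp, lintegral_const, lintegral_const,
    measure_univ, mul_one, mul_one, ← hmdef] at hint
  -- After integration, where `p` averages to `m`, the surplus is `m log (m / q) + q - m`, which is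
  -- nonnegative by `hpos`.
  have hle : m * ENNReal.ofReal (-c) + m ≤ m * ENNReal.ofReal c + q := by
    have hma : m = ENNReal.ofReal m.toReal := (ENNReal.ofReal_toReal hm).symm
    have hqa : q = ENNReal.ofReal q.toReal := (ENNReal.ofReal_toReal hq).symm
    have hm0' : 0 ≤ m.toReal := ENNReal.toReal_nonneg
    have hq0' : 0 ≤ q.toReal := ENNReal.toReal_nonneg
    generalize m.toReal = y at *
    generalize q.toReal = w at *
    rw [hma, hqa, ← ENNReal.ofReal_mul hm0', ← ENNReal.ofReal_mul hm0']
    rcases le_total 0 c with h | h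
    · have : ENNReal.ofReal (y * -c) = 0 := ENNReal.ofReal_of_nonpos (by nlinarith)
      rw [this, zero_add, ← ENNReal.ofReal_add (by positivity) hq0']
      refine ENNReal.ofReal_le_ofReal ?_
      rw [hc]; nlinarith
    · have : ENNReal.ofReal (y * c) = 0 := ENNReal.ofReal_of_nonpos (by nlinarith)
      have h' : 0 ≤ -c := by linarith
      rw [this, zero_add, ← ENNReal.ofReal_add (by positivity) hm0']
      refine ENNReal.ofReal_le_ofReal ?_
      rw [hc]; nlinarith
  have hfin : m * ENNReal.ofReal (-c) + m ≠ ∞ :=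
    ENNReal.add_ne_top.2 ⟨ENNReal.mul_ne_top hm ENNReal.ofReal_ne_top, hm⟩
  refine (ENNReal.add_le_add_iff_right hfin).1 ?_
  calc _ ≤ _ := add_le_add le_rfl hle
    _ = _ := hint.symm

end InformationTheory

/-! ### Mean divergence of conditional laws against an arbitrary prediction. -/

namespace ProbabilityTheory

variable {Ω 𝓩 O : Type*} [MeasurableSpace Ω] [MeasurableSpace 𝓩] [MeasurableSpace O]
  {P : Measure Ω} [IsProbabilityMeasure P] {Z : Ω → 𝓩} {Θ : Ω → O} {R : Ω → ℝ}

/-- Integrating a latent variable out of a conditional distribution. -/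
lemma HasCondDistrib.mixture {π : Kernel 𝓩 O} [IsSFiniteKernel π] {κ : Kernel (𝓩 × O) ℝ}
    [IsSFiniteKernel κ] (hΘ : HasCondDistrib Θ Z π P)
    (hR : HasCondDistrib R (fun ω => (Z ω, Θ ω)) κ P) :
    HasCondDistrib R Z (π ⊗ₖ κ).snd P := by
  have h : HasCondDistrib (fun ω => (Θ ω, R ω)) Z (π ⊗ₖ κ) P := by
    have hZ := hΘ.aemeasurable_fst
    have hΘm := hΘ.aemeasurable_snd
    have hRm := hR.aemeasurable_snd
    refine ⟨by fun_prop, ?_⟩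
    calc P.map (fun ω => (Z ω, Θ ω, R ω))
        = (P.map (fun ω => ((Z ω, Θ ω), R ω))).map MeasurableEquiv.prodAssoc := by
          rw [AEMeasurable.map_map_of_aemeasurable (by fun_prop) (by fun_prop)]
          rfl
      _ = (P.map Z ⊗ₘ π ⊗ₘ κ).map MeasurableEquiv.prodAssoc := by
          rw [hR.map_eq, hΘ.map_eq]
      _ = P.map Z ⊗ₘ (π ⊗ₖ κ) := Measure.compProd_assoc'
  exact h.snd

lemma HasCondDistrib.condDistrib_comp_ae_eq {𝓧 : Type*} [MeasurableSpace 𝓧] {X : Ω → 𝓧}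
    {η : Kernel 𝓧 ℝ} [IsFiniteKernel η] (h : HasCondDistrib R X η P) :
    ∀ᵐ ω ∂P, condDistrib R X P (X ω) = η (X ω) :=
  ae_of_ae_map h.aemeasurable_fst
    (condDistrib_ae_eq_of_measure_eq_compProd X h.aemeasurable_snd h.map_eq)

open InformationTheory

variable {π : Kernel 𝓩 O} [IsMarkovKernel π] {κ : Kernel (𝓩 × O) ℝ} [IsMarkovKernel κ]
  {μ : Measure ℝ} [SigmaFinite μ] {p : 𝓩 × O → ℝ → ℝ≥0∞} {q : 𝓩 → ℝ → ℝ≥0∞}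

lemma snd_compProd_eq_withDensity (hp : Measurable (Function.uncurry p))
    (hκ : ∀ y, κ y = μ.withDensity (p y)) (z : 𝓩) :
    (π ⊗ₖ κ).snd z = μ.withDensity fun r => ∫⁻ θ, p (z, θ) r ∂π z := by
  ext s hs
  have hpz : Measurable fun x : O × ℝ => p (z, x.1) x.2 :=
    hp.comp (by fun_prop : Measurable fun x : O × ℝ => ((z, x.1), x.2))
  rw [Kernel.snd_apply' _ _ hs, Kernel.compProd_apply (measurable_snd hs), withDensity_apply _ hs,
    ← lintegral_lintegral_swap hpz.aemeasurable]
  refine lintegral_congr fun θ => ?_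
  rw [hκ, ← withDensity_apply _ hs]
  rfl

/-- The mean Kullback-Leibler divergence is bounded by that of any prediction `q`, in the form of
an integral of `klIntegrand`. -/
lemma lintegral_klDiv_condDistrib_le_lintegral_klIntegrand
    (hp : Measurable (Function.uncurry p)) (hκ : ∀ y, κ y = μ.withDensity (p y))
    (hΘ : HasCondDistrib Θ Z π P) (hR : HasCondDistrib R (fun ω => (Z ω, Θ ω)) κ P)
    (hq : Measurable (Function.uncurry q)) (hq1 : ∀ z, ∫⁻ r, q z r ∂μ ≤ 1)
    (hqpos : ∀ᵐ ω ∂P, q (Z ω) (R ω) ≠ 0) :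
    ∫⁻ ω, klDiv (condDistrib R (fun ω' => (Z ω', Θ ω')) P (Z ω, Θ ω))
        (condDistrib R Z P (Z ω)) ∂P ≤
      ∫⁻ y, klIntegrand (p y.1 y.2) (q y.1.1 y.2) ∂((P.map fun ω => (Z ω, Θ ω)).prod μ) := by
  have hZ := hΘ.aemeasurable_fst
  have hΘm := hΘ.aemeasurable_snd
  have hRm := hR.aemeasurable_snd
  have hPZ : IsProbabilityMeasure (P.map Z) := Measure.isProbabilityMeasure_map hZ
  set m : 𝓩 → ℝ → ℝ≥0∞ := fun z r => ∫⁻ θ, p (z, θ) r ∂π z with hmdef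
  have hp3 : Measurable fun x : (𝓩 × ℝ) × O => p (x.1.1, x.2) x.1.2 :=
    hp.comp (by fun_prop : Measurable fun x : (𝓩 × ℝ) × O => ((x.1.1, x.2), x.1.2))
  have hm : Measurable (Function.uncurry m) :=
    hp3.lintegral_kernel_prod_right' (κ := π.comap Prod.fst measurable_fst)
  have hM := snd_compProd_eq_withDensity (π := π) hp hκ
  have hRZ := hΘ.mixture hR
  have hp1 : ∀ y, ∫⁻ r, p y r ∂μ = 1 := fun y => by
    have : κ y Set.univ = 1 := measure_univ
    rwa [hκ, withDensity_apply _ MeasurableSet.univ, setLIntegral_univ] at this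
  have hm1 : ∀ z, ∫⁻ r, m z r ∂μ = 1 := fun z => by
    have : (π ⊗ₖ κ).snd z Set.univ = 1 := measure_univ
    rwa [hM, withDensity_apply _ MeasurableSet.univ, setLIntegral_univ] at this
  have hpz : ∀ z, Measurable fun x : O × ℝ => p (z, x.1) x.2 := fun z =>
    hp.comp (by fun_prop : Measurable fun x : O × ℝ => ((z, x.1), x.2))
  have hpr : ∀ z r, Measurable fun θ => p (z, θ) r := fun z r =>
    hp.comp (by fun_prop : Measurable fun θ : O => ((z, θ), r))
  have hpy : ∀ y, Measurable (p y) := fun y => hp.comp measurable_prodMk_left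
  have hmz : ∀ z, Measurable (m z) := fun z => hm.comp measurable_prodMk_left
  have hqz : ∀ z, Measurable (q z) := fun z => hq.comp measurable_prodMk_left
  have hkl : ∀ y : 𝓩 × O, (∀ᵐ r ∂μ, m y.1 r = 0 → p y r = 0) → klDiv (κ y)
      ((π ⊗ₖ κ).snd y.1) = ∫⁻ r, klIntegrand (p y r) (m y.1 r) ∂μ := fun y hy => by
    rw [hκ, hM]
    exact klDiv_withDensity (hpy y) (hmz _) (by simp [hp1]) (by rw [hm1]; simp) hy
  -- For fixed `z` and `r`, a vanishing mixture density forces `p (z, θ) r = 0` for `π z`-almost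
  -- every `θ`; exchanging the quantifiers gives domination in `r`.
  have hzero : ∀ᵐ y ∂(P.map fun ω => (Z ω, Θ ω)), ∀ᵐ r ∂μ, m y.1 r = 0 → p y r = 0 := by
    have hms : MeasurableSet {x : (𝓩 × O) × ℝ | m x.1.1 x.2 = 0 → p x.1 x.2 = 0} := by
      have h1 : MeasurableSet {x : (𝓩 × O) × ℝ | m x.1.1 x.2 = 0} :=
        (hm.comp (by fun_prop : Measurable fun x : (𝓩 × O) × ℝ => (x.1.1, x.2)))
          (measurableSet_singleton 0)
      have h2 : MeasurableSet {x : (𝓩 × O) × ℝ | p x.1 x.2 = 0} := hp (measurableSet_singleton 0)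
      exact h1.imp h2
    rw [hΘ.map_eq]
    refine Measure.ae_compProd_of_ae_ae ?_ (.of_forall fun z => ?_)
    · exact (measurable_measure_prodMk_left hms.compl) (measurableSet_singleton 0)
    · refine (Measure.ae_ae_comm ?_).1 (.of_forall fun r => ?_)
      · exact hms.preimage (by fun_prop : Measurable fun x : ℝ × O => ((z, x.2), x.1))
      · by_cases h : m z r = 0
        · filter_upwards [(lintegral_eq_zero_iff (hpr z r)).1 h] with θ hθ _ using hθ
        · exact .of_forall fun θ h' => absurd h' h
  have hleft : ∀ᵐ ω ∂P, klDiv (condDistrib R (fun ω' => (Z ω', Θ ω')) P (Z ω, Θ ω))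
      (condDistrib R Z P (Z ω)) = ∫⁻ r, klIntegrand (p (Z ω, Θ ω) r) (m (Z ω) r) ∂μ := by
    filter_upwards [hR.condDistrib_comp_ae_eq, hRZ.condDistrib_comp_ae_eq,
      ae_of_ae_map (by fun_prop) hzero] with ω h1 h2 h3
    rw [h1, h2, hkl _ h3]
  have hKm : Measurable fun x : (𝓩 × O) × ℝ => klIntegrand (p x.1 x.2) (m x.1.1 x.2) :=
    hp.klIntegrand (hm.comp (by fun_prop : Measurable fun x : (𝓩 × O) × ℝ => (x.1.1, x.2)))
  have hKq : Measurable fun x : (𝓩 × O) × ℝ => klIntegrand (p x.1 x.2) (q x.1.1 x.2) :=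
    hp.klIntegrand (hq.comp (by fun_prop : Measurable fun x : (𝓩 × O) × ℝ => (x.1.1, x.2)))
  -- Given `Z = z` the reward has density `m z`, so positivity of `q` at the observed reward means
  -- positivity `μ`-almost everywhere on the support of `m z`.
  have hzr : ∀ᵐ z ∂(P.map Z), ∀ᵐ r ∂μ, m z r ≠ 0 → q z r ≠ 0 := by
    have h : ∀ᵐ x ∂(P.map fun ω => (Z ω, R ω)), q x.1 x.2 ≠ 0 :=
      (ae_map_iff (by fun_prop) (hq (measurableSet_singleton 0).compl)).2 hqpos
    rw [hRZ.map_eq] at h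
    filter_upwards [Measure.ae_ae_of_ae_compProd h] with z hz
    rw [hM] at hz
    exact (ae_withDensity_iff (hmz z)).1 hz
  rw [lintegral_congr_ae hleft, lintegral_prod _ hKq.aemeasurable, hΘ.map_eq,
    Measure.lintegral_compProd hKq.lintegral_prod_right']
  have e1 : ∫⁻ ω, ∫⁻ r, klIntegrand (p (Z ω, Θ ω) r) (m (Z ω) r) ∂μ ∂P
      = ∫⁻ z, ∫⁻ θ, ∫⁻ r, klIntegrand (p (z, θ) r) (m z r) ∂μ ∂π z ∂P.map Z := by
    rw [← Measure.lintegral_compProd (f := fun y => ∫⁻ r, klIntegrand (p y r) (m y.1 r) ∂μ)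
      hKm.lintegral_prod_right', ← hΘ.map_eq]
    exact (lintegral_map' hKm.lintegral_prod_right'.aemeasurable (by fun_prop)).symm
  rw [e1]
  refine lintegral_mono_ae ?_
  filter_upwards [hzr] with z hz
  -- With the parameter integrated first, the mixture inequality applies separately at each reward
  -- value.
  have swap : ∀ g : ℝ → ℝ≥0∞, Measurable g →
      ∫⁻ θ, ∫⁻ r, klIntegrand (p (z, θ) r) (g r) ∂μ ∂π z =
      ∫⁻ r, ∫⁻ θ, klIntegrand (p (z, θ) r) (g r) ∂π z ∂μ := fun g hg =>
    lintegral_lintegral_swap ((hpz z).klIntegrand (hg.comp measurable_snd)).aemeasurable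
  rw [swap _ (hmz z), swap _ (hqz z)]
  refine lintegral_mono_ae ?_
  filter_upwards [hz, ae_lt_top (hmz z) (by rw [hm1]; simp),
    ae_lt_top (hqz z) ((hq1 z).trans_lt (by simp)).ne] with r h1 h2 h3
  exact lintegral_klIntegrand_mixture_le (hpr z r) h3.ne h2.ne (fun h => by
    by_contra h'; exact h1 h' h)

end ProbabilityTheory

namespace ProbabilityTheory
open InformationTheory

variable {Ω 𝓩 O : Type*} [MeasurableSpace Ω] [MeasurableSpace 𝓩] [MeasurableSpace O]
  {P : Measure Ω} [IsProbabilityMeasure P] {Z : Ω → 𝓩} {Θ : Ω → O} {R : Ω → ℝ}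
  {π : Kernel 𝓩 O} [IsMarkovKernel π] {κ : Kernel (𝓩 × O) ℝ} [IsMarkovKernel κ]
  {μ : Measure ℝ} [SigmaFinite μ] {p : 𝓩 × O → ℝ → ℝ≥0∞} {q : 𝓩 → ℝ → ℝ≥0∞}

/-- The mean divergence between the conditional laws of `R` given `(Z, Θ)` and given `Z` is at most
the mean log-likelihood ratio of the true density `p` and any prediction `q`. -/
theorem lintegral_klDiv_condDistrib_le
    (hp : Measurable (Function.uncurry p)) (hκ : ∀ y, κ y = μ.withDensity (p y))
    (hΘ : HasCondDistrib Θ Z π P) (hR : HasCondDistrib R (fun ω => (Z ω, Θ ω)) κ P)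
    (hq : Measurable (Function.uncurry q)) (hq1 : ∀ z, ∫⁻ r, q z r ∂μ ≤ 1)
    (hqpos : ∀ᵐ ω ∂P, q (Z ω) (R ω) ≠ 0)
    (hint : Integrable (fun ω => Real.log (p (Z ω, Θ ω) (R ω)).toReal -
      Real.log (q (Z ω) (R ω)).toReal) P) :
    ∫⁻ ω, klDiv (condDistrib R (fun ω' => (Z ω', Θ ω')) P (Z ω, Θ ω))
        (condDistrib R Z P (Z ω)) ∂P ≤
      ENNReal.ofReal (∫ ω, Real.log (p (Z ω, Θ ω) (R ω)).toReal -
        Real.log (q (Z ω) (R ω)).toReal ∂P) ∧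
    0 ≤ ∫ ω, Real.log (p (Z ω, Θ ω) (R ω)).toReal - Real.log (q (Z ω) (R ω)).toReal ∂P := by
  have hZ := hΘ.aemeasurable_fst
  have hΘm := hΘ.aemeasurable_snd
  have hRm := hR.aemeasurable_snd
  have hPZ : IsProbabilityMeasure (P.map fun ω => (Z ω, Θ ω)) :=
    Measure.isProbabilityMeasure_map (by fun_prop)
  set ν := (P.map fun ω => (Z ω, Θ ω)).prod μ with hν
  have hp1 : ∀ y, ∫⁻ r, p y r ∂μ = 1 := fun y => by
    have : κ y Set.univ = 1 := measure_univ
    rwa [hκ, withDensity_apply _ MeasurableSet.univ, setLIntegral_univ] at this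
  have hq' : Measurable fun x : (𝓩 × O) × ℝ => q x.1.1 x.2 :=
    hq.comp (by fun_prop : Measurable fun x : (𝓩 × O) × ℝ => (x.1.1, x.2))
  have hp' : Measurable fun x : (𝓩 × O) × ℝ => p x.1 x.2 := hp
  have hJ : P.map (fun ω => ((Z ω, Θ ω), R ω)) = ν.withDensity fun x => p x.1 x.2 := by
    rw [hR.map_eq]
    ext s hs
    rw [Measure.compProd_apply hs, withDensity_apply _ hs, ← lintegral_indicator hs,
      lintegral_prod _ (hp'.indicator hs).aemeasurable]
    refine lintegral_congr fun y => ?_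
    rw [hκ, withDensity_apply _ (measurable_prodMk_left hs),
      ← lintegral_indicator (measurable_prodMk_left hs)]
    rfl
  have hpν : ∫⁻ x, p x.1 x.2 ∂ν = 1 := by
    rw [lintegral_prod _ hp'.aemeasurable]; simp [hp1]
  have hqν : ∫⁻ x, q x.1.1 x.2 ∂ν ≤ 1 := by
    rw [lintegral_prod _ hq'.aemeasurable]
    calc _ ≤ ∫⁻ y : 𝓩 × O, 1 ∂(P.map fun ω => (Z ω, Θ ω)) := lintegral_mono fun y => hq1 _
      _ = 1 := by simp
  have hpfin := ae_lt_top hp' (by rw [hpν]; simp)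
  have hqfin := ae_lt_top hq' (hqν.trans_lt (by simp)).ne
  have hq0 : ∀ᵐ x ∂ν, p x.1 x.2 ≠ 0 → q x.1.1 x.2 ≠ 0 := by
    have h : ∀ᵐ x ∂(P.map fun ω => ((Z ω, Θ ω), R ω)), q x.1.1 x.2 ≠ 0 :=
      (ae_map_iff (by fun_prop) (hq' (measurableSet_singleton 0).compl)).2 hqpos
    rw [hJ] at h
    exact (ae_withDensity_iff hp').1 h
  set g : (𝓩 × O) × ℝ → ℝ := fun x => Real.log (p x.1 x.2).toReal - Real.log (q x.1.1 x.2).toReal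
    with hg
  have hgm : Measurable g := by fun_prop
  have hgi : Integrable g (ν.withDensity fun x => p x.1 x.2) := by
    rw [← hJ]
    exact (integrable_map_measure hgm.aestronglyMeasurable (by fun_prop)).2 hint
  have hgi' : Integrable (fun x => (p x.1 x.2).toReal * g x) ν := by
    simpa using (integrable_withDensity_iff_integrable_smul' hp' hpfin).1 hgi
  have hgeq : ∫ ω, Real.log (p (Z ω, Θ ω) (R ω)).toReal - Real.log (q (Z ω) (R ω)).toReal ∂P =
      ∫ x, (p x.1 x.2).toReal * g x ∂ν := by
    have h1 : ∫ ω, g ((Z ω, Θ ω), R ω) ∂P = ∫ x, g x ∂(P.map fun ω => ((Z ω, Θ ω), R ω)) :=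
      (integral_map (by fun_prop) hgm.aestronglyMeasurable).symm
    have h2 := integral_withDensity_eq_integral_toReal_smul hp' hpfin g
    rw [hJ, h2] at h1
    simpa using h1
  have hpi : Integrable (fun x : (𝓩 × O) × ℝ => (p x.1 x.2).toReal) ν :=
    integrable_toReal_of_lintegral_ne_top hp'.aemeasurable (by rw [hpν]; simp)
  have hqi : Integrable (fun x : (𝓩 × O) × ℝ => (q x.1.1 x.2).toReal) ν :=
    integrable_toReal_of_lintegral_ne_top hq'.aemeasurable (hqν.trans_lt (by simp)).ne
  have hpI : ∫ x, (p x.1 x.2).toReal ∂ν = 1 := by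
    rw [integral_toReal hp'.aemeasurable hpfin, hpν]; simp
  have hqI : ∫ x, (q x.1.1 x.2).toReal ∂ν ≤ 1 := by
    rw [integral_toReal hq'.aemeasurable hqfin]
    exact ENNReal.toReal_le_of_le_ofReal zero_le_one (by simpa using hqν)
  -- A real-valued version of the integrand, almost everywhere nonnegative. Since `q` has mass at
  -- most one and `p` mass one, its integral is at most that of `p * g`, the mean log-likelihood
  -- ratio; this gives both conclusions.
  set k : (𝓩 × O) × ℝ → ℝ := fun x =>
    (p x.1 x.2).toReal * g x + (q x.1.1 x.2).toReal - (p x.1 x.2).toReal with hk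
  have hki : Integrable k ν := (hgi'.add hqi).sub hpi
  have hkI : ∫ x, k x ∂ν = ∫ x, (p x.1 x.2).toReal * g x ∂ν
      + ∫ x, (q x.1.1 x.2).toReal ∂ν - ∫ x, (p x.1 x.2).toReal ∂ν := by
    have e1 := integral_sub (hgi'.add hqi) hpi
    have e2 := integral_add hgi' hqi
    simp only [Pi.add_apply] at e1
    rw [e2] at e1
    exact e1
  have hkey : ∀ᵐ x ∂ν, 0 ≤ k x ∧ klIntegrand (p x.1 x.2) (q x.1.1 x.2) = ENNReal.ofReal (k x) := by
    filter_upwards [hqfin, hq0] with x h1 h2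
    rcases eq_or_ne (q x.1.1 x.2) 0 with h | h
    · have hp0 : p x.1 x.2 = 0 := by by_contra h'; exact h2 h' h
      simp [hk, h, hp0, klIntegrand_zero_right]
    · have e : k x = (p x.1 x.2).toReal * Real.log (p x.1 x.2).toReal - (p x.1 x.2).toReal *
          Real.log (q x.1.1 x.2).toReal + (q x.1.1 x.2).toReal - (p x.1 x.2).toReal := by
        simp only [hk, hg]; ring
      rw [e, klIntegrand_eq_ofReal h h1.ne]
      exact ⟨mul_log_sub_nonneg ENNReal.toReal_nonneg (ENNReal.toReal_pos h h1.ne), rfl⟩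
  have hk0 : 0 ≤ ∫ x, k x ∂ν := integral_nonneg_of_ae (hkey.mono fun x hx => hx.1)
  rw [hgeq]
  refine ⟨?_, by linarith⟩
  refine (lintegral_klDiv_condDistrib_le_lintegral_klIntegrand hp hκ hΘ hR hq hq1 hqpos).trans ?_
  rw [lintegral_congr_ae (hkey.mono fun x hx => hx.2),
    ← ofReal_integral_eq_lintegral_ofReal hki (hkey.mono fun x hx => hx.1)]
  exact ENNReal.ofReal_le_ofReal (by linarith)

end ProbabilityTheory

/-! ### Domination by product measures: from fixed parameters to the random one. -/

namespace MeasureTheory.Measure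

/-- A measure dominated by a product measure is dominated by the product of the first factor and
its own second marginal. -/
lemma AbsolutelyContinuous.prod_snd {α β : Type*} [MeasurableSpace α] [MeasurableSpace β]
    {τ : Measure α} [SFinite τ] {ν : Measure β} [SigmaFinite ν] {J : Measure (α × β)}
    [IsFiniteMeasure J] (h : J ≪ τ.prod ν) : J ≪ τ.prod J.snd := by
  have hsnd : J.snd ≪ ν := by
    refine AbsolutelyContinuous.mk fun s hs h0 => ?_
    rw [snd_apply hs]
    refine h ?_
    rw [← Set.univ_prod, prod_prod, h0, mul_zero]
  -- `J` is carried by the region `g ≠ 0`, and on that region null sets of `J.snd` are null for `ν`.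
  set g := J.snd.rnDeriv ν with hg
  have hgm : Measurable g := measurable_rnDeriv _ _
  have hJ : J.snd = ν.withDensity g := (withDensity_rnDeriv_eq _ _ hsnd).symm
  refine AbsolutelyContinuous.mk fun B hB h0 => ?_
  have h1 : ∀ᵐ x ∂τ, ∀ᵐ y ∂ν, g y ≠ 0 → (x, y) ∉ B := by
    have h2 : ∀ᵐ z ∂τ.prod J.snd, z ∉ B := measure_eq_zero_iff_ae_notMem.1 h0
    filter_upwards [ae_ae_of_ae_prod h2] with x hx
    rw [hJ] at hx
    exact (ae_withDensity_iff hgm).1 hx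
  have hg0 : MeasurableSet {z : α × β | g z.2 = 0} :=
    (hgm.comp measurable_snd) (measurableSet_singleton 0)
  have h3 : ∀ᵐ z ∂τ.prod ν, g z.2 ≠ 0 → z ∉ B :=
    (ae_prod_iff_ae_ae (hg0.compl.imp hB.compl)).2 h1
  have h4 : ∀ᵐ z ∂J, g z.2 ≠ 0 := by
    have h5 : ∀ᵐ y ∂J.snd, g y ≠ 0 := by
      rw [hJ, ae_withDensity_iff hgm]
      exact .of_forall fun _ h => h
    exact ae_of_ae_map measurable_snd.aemeasurable h5
  refine measure_eq_zero_iff_ae_notMem.2 ?_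
  filter_upwards [h.ae_le h3, h4] with z h5 h6 using h5 h6

end MeasureTheory.Measure

namespace ProbabilityTheory

variable {Ω O 𝓦 𝓨 : Type*} [MeasurableSpace Ω] [MeasurableSpace O] [MeasurableSpace 𝓦]
  [MeasurableSpace 𝓨] {P : Measure Ω} [IsProbabilityMeasure P] {τ : Measure O}
  {Θ : Ω → O} {W : Ω → 𝓦} {Y : Ω → 𝓨}

lemma absolutelyContinuous_prod_map_comp [SFinite τ] (hΘ : Measurable Θ) (hW : Measurable W)
    (h : P.map (fun ω => (Θ ω, W ω)) ≪ τ.prod (P.map W)) {φ : 𝓦 → 𝓨} (hφ : Measurable φ) :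
    P.map (fun ω => (Θ ω, φ (W ω))) ≪ τ.prod (P.map fun ω => φ (W ω)) := by
  have h1 := h.map (measurable_id.prodMap hφ)
  rw [Measure.map_map (measurable_id.prodMap hφ) (by fun_prop),
    ← Measure.map_prod_map _ _ measurable_id hφ, Measure.map_id, Measure.map_map hφ hW] at h1
  exact h1

lemma absolutelyContinuous_prod_map_const [SFinite τ] (hΘ : HasLaw Θ τ P) (c : 𝓦) :
    P.map (fun ω => (Θ ω, c)) ≪ τ.prod (P.map fun _ => c) := by
  rw [Measure.map_const, measure_univ, one_smul, Measure.prod_dirac, ← hΘ.map_eq,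
    AEMeasurable.map_map_of_aemeasurable (by fun_prop) hΘ.aemeasurable]
  exact Measure.AbsolutelyContinuous.rfl

/-- If the law of `(Θ, W)` is dominated by the product of a fixed measure and the law of `W`, this
remains true after adjoining to `W` a variable whose conditional law given `(Θ, W)` is dominated by
a kernel which does not depend on `Θ`. -/
lemma absolutelyContinuous_prod_map_prodMk [SFinite τ] (hΘ : Measurable Θ)
    (hW : Measurable W) (hY : Measurable Y) (h : P.map (fun ω => (Θ ω, W ω)) ≪ τ.prod (P.map W))
    {κ : Kernel (O × 𝓦) 𝓨} [IsSFiniteKernel κ]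
    (hκ : HasCondDistrib Y (fun ω => (Θ ω, W ω)) κ P) (η : Kernel 𝓦 𝓨) [IsFiniteKernel η]
    (hη : ∀ y, κ y ≪ η y.2) :
    P.map (fun ω => (Θ ω, W ω, Y ω)) ≪ τ.prod (P.map fun ω => (W ω, Y ω)) := by
  have hPW : IsProbabilityMeasure (P.map W) := Measure.isProbabilityMeasure_map (by fun_prop)
  have hPJ : IsProbabilityMeasure (P.map (fun ω => (Θ ω, W ω, Y ω))) :=
    Measure.isProbabilityMeasure_map (by fun_prop)
  -- Domination by any product with first factor `τ` is enough: `prod_snd` then replaces the second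
  -- factor by the actual law of `(W, Y)`.
  suffices hac : P.map (fun ω => (Θ ω, W ω, Y ω)) ≪ τ.prod (P.map W ⊗ₘ η) by
    have := hac.prod_snd
    rwa [Measure.snd_map_prodMk hΘ] at this
  refine Measure.AbsolutelyContinuous.mk fun B hB h0 => ?_
  have hB' : MeasurableSet {z : (O × 𝓦) × 𝓨 | (z.1.1, z.1.2, z.2) ∉ B} :=
    hB.compl.preimage (by fun_prop : Measurable fun z : (O × 𝓦) × 𝓨 => (z.1.1, z.1.2, z.2))
  have h1 : ∀ᵐ x ∂τ, ∀ᵐ w ∂P.map W, ∀ᵐ y ∂η w, (x, w, y) ∉ B := by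
    filter_upwards [Measure.ae_ae_of_ae_prod (measure_eq_zero_iff_ae_notMem.1 h0)] with x hx
    exact Measure.ae_ae_of_ae_compProd hx
  have h2 : ∀ᵐ z ∂τ.prod (P.map W), ∀ᵐ y ∂η z.2, (z.1, z.2, y) ∉ B := by
    refine (Measure.ae_prod_iff_ae_ae ?_).2 h1
    exact (Kernel.measurable_kernel_prodMk_left (κ := η.comap Prod.snd measurable_snd) hB'.compl)
      (measurableSet_singleton 0)
  have h3 : ∀ᵐ z ∂P.map (fun ω => ((Θ ω, W ω), Y ω)), (z.1.1, z.1.2, z.2) ∉ B := by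
    rw [hκ.map_eq]
    refine Measure.ae_compProd_of_ae_ae hB' ?_
    filter_upwards [h.ae_le h2] with z hz
    exact (hη z).ae_le hz
  rw [Measure.map_apply (by fun_prop) hB]
  have h4 := ae_of_ae_map (by fun_prop) h3
  exact measure_eq_zero_iff_ae_notMem.2 h4

/-- Almost sure properties for all fixed parameters hold at the random parameter. -/
lemma ae_mem_of_forall_ae_mem (hΘ : Measurable Θ) (hW : Measurable W)
    (h : P.map (fun ω => (Θ ω, W ω)) ≪ τ.prod (P.map W)) {s : Set (O × 𝓦)} (hs : MeasurableSet s)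
    (hae : ∀ θ, ∀ᵐ ω ∂P, (θ, W ω) ∈ s) : ∀ᵐ ω ∂P, (Θ ω, W ω) ∈ s := by
  have h1 : ∀ᵐ z ∂τ.prod (P.map W), z ∈ s := by
    refine (Measure.ae_prod_iff_ae_ae hs).2 (.of_forall fun θ => ?_)
    exact (ae_map_iff hW.aemeasurable (measurable_prodMk_left hs)).2 (hae θ)
  exact ae_of_ae_map (by fun_prop) (h.ae_le h1)

end ProbabilityTheory

/-! ### Domination along a run of Thompson sampling. -/

namespace ThompsonSampling

variable {O X A Ω : Type*} [MeasurableSpace O] [MeasurableSpace X] [MeasurableSpace A]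
  [MeasurableSpace Ω] {Φ : ContextualBandit O X A} {ψ : X × O → A} {T : ℕ} {P : Measure Ω}

@[fun_prop]
lemma measurable_act (S : ThompsonSampling Φ ψ T P) (t : ℕ) : Measurable (S.act t) :=
  S.measurable_rule.comp ((S.measurable_ctx t).prodMk (S.measurable_est t))

@[fun_prop]
lemma measurable_hist (S : ThompsonSampling Φ ψ T P) (t : ℕ) : Measurable (S.hist t) :=
  measurable_pi_lambda _ fun i => (S.measurable_act i).prodMk
    ((S.measurable_ctx i).prodMk (S.measurable_rew i))

lemma hist_succ (S : ThompsonSampling Φ ψ T P) (t : ℕ) (ω : Ω) :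
    S.hist (t + 1) ω = Fin.snoc (α := fun _ => A × X × ℝ) (S.hist t ω)
      (S.act t ω, S.ctx t ω, S.rew t ω) := by
  funext i
  refine Fin.lastCases ?_ (fun j => ?_) i
  · rw [Fin.snoc_last]; rfl
  · rw [Fin.snoc_castSucc]; rfl

lemma _root_.measurable_fin_snoc {β : Type*} [MeasurableSpace β] (t : ℕ) :
    Measurable fun z : (Fin t → β) × β => Fin.snoc (α := fun _ => β) z.1 z.2 := by
  refine measurable_pi_lambda _ fun i => ?_
  refine Fin.lastCases ?_ (fun j => ?_) i
  · simp only [Fin.snoc_last]; fun_prop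
  · simp only [Fin.snoc_castSucc]; fun_prop

variable [IsProbabilityMeasure P] {μ : Measure ℝ} [SigmaFinite μ] {f : X × A × O → ℝ → ℝ}

/-- Context, sampled parameter and reward are adjoined in turn. The kernels of the first two do not
involve `Θ` and dominate themselves; the reward kernel has densities with respect to the single
measure `μ`. -/
lemma absolutelyContinuous_round_of_hist (S : ThompsonSampling Φ ψ T P) (hf : Φ.IsLikelihood μ f)
    {t : ℕ} (ht : t < T)
    (h : P.map (fun ω => (S.param ω, S.hist t ω)) ≪ Φ.prior.prod (P.map (S.hist t))) :
    P.map (fun ω => (S.param ω, (S.hist t ω, S.ctx t ω, S.est t ω), S.rew t ω)) ≪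
      Φ.prior.prod (P.map fun ω => ((S.hist t ω, S.ctx t ω, S.est t ω), S.rew t ω)) := by
  have := Φ.isProbabilityMeasure_prior
  have := Φ.isProbabilityMeasure_context
  have := Φ.isMarkovKernel_reward
  have := S.isMarkovKernel_posterior t
  have hΘ := S.measurable_param
  have hX := S.measurable_ctx t
  have hE := S.measurable_est t
  have hRm := S.measurable_rew t
  have hH := S.measurable_hist t
  have h1 := absolutelyContinuous_prod_map_prodMk hΘ hH hX h (S.hasCondDistrib_ctx t ht)
    (Kernel.const _ Φ.context) fun _ => .rfl
  have h2 := absolutelyContinuous_prod_map_prodMk hΘ (hH.prodMk hX) hE h1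
    (S.hasCondDistrib_est t ht)
    ((S.posterior t).comap (fun z : History X A t × X => z.1) measurable_fst) fun _ => .rfl
  have h3 := absolutelyContinuous_prod_map_comp hΘ ((hH.prodMk hX).prodMk hE) h2
    (φ := fun z => (z.1.1, z.1.2, z.2)) (by fun_prop)
  -- `μ` is only `σ`-finite, so an equivalent finite measure serves as the dominating kernel.
  refine absolutelyContinuous_prod_map_prodMk hΘ (hH.prodMk (hX.prodMk hE)) hRm h3
    (S.hasCondDistrib_rew t ht) (Kernel.const _ μ.toFinite) fun y => ?_
  rw [Kernel.comap_apply, hf.2, Kernel.const_apply]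
  exact (withDensity_absolutelyContinuous _ _).trans (absolutelyContinuous_toFinite μ)

lemma absolutelyContinuous_hist (S : ThompsonSampling Φ ψ T P) (hf : Φ.IsLikelihood μ f)
    {t : ℕ} (ht : t ≤ T) :
    P.map (fun ω => (S.param ω, S.hist t ω)) ≪ Φ.prior.prod (P.map (S.hist t)) := by
  have := Φ.isProbabilityMeasure_prior
  induction t with
  | zero =>
    have e : S.hist 0 = fun _ => Fin.elim0 := funext fun ω => Subsingleton.elim _ _
    rw [e]
    exact absolutelyContinuous_prod_map_const S.hasLaw_param _
  | succ t ih =>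
    have h1 := S.absolutelyContinuous_round_of_hist hf ht (ih (Nat.le_of_succ_le ht))
    have hX := S.measurable_ctx t
    have hE := S.measurable_est t
    have hRm := S.measurable_rew t
    have hψ := S.measurable_rule
    have h2 := absolutelyContinuous_prod_map_comp S.measurable_param
      (((S.measurable_hist t).prodMk (hX.prodMk hE)).prodMk hRm) h1
      (φ := fun z => Fin.snoc (α := fun _ => A × X × ℝ) z.1.1 (ψ z.1.2, z.1.2.1, z.2))
      ((measurable_fin_snoc t).comp
        (by fun_prop : Measurable fun z : (History X A t × X × O) × ℝ =>
          (z.1.1, (ψ z.1.2, z.1.2.1, z.2))))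
    have e : S.hist (t + 1) = fun ω => Fin.snoc (α := fun _ => A × X × ℝ) (S.hist t ω)
      (ψ (S.ctx t ω, S.est t ω), S.ctx t ω, S.rew t ω) := funext (S.hist_succ t)
    rw [e]
    exact h2

/-- Keeps exactly the observations that enter the Lipschitz hypothesis. -/
lemma absolutelyContinuous_round (S : ThompsonSampling Φ ψ T P) (hf : Φ.IsLikelihood μ f)
    {t : ℕ} (ht : t < T) :
    P.map (fun ω => (S.param ω, S.rew t ω, S.ctx t ω, S.act t ω)) ≪
      Φ.prior.prod (P.map fun ω => (S.rew t ω, S.ctx t ω, S.act t ω)) := by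
  have := Φ.isProbabilityMeasure_prior
  have hψ := S.measurable_rule
  exact absolutelyContinuous_prod_map_comp S.measurable_param
    (((S.measurable_hist t).prodMk ((S.measurable_ctx t).prodMk (S.measurable_est t))).prodMk
      (S.measurable_rew t))
    (S.absolutelyContinuous_round_of_hist hf ht (S.absolutelyContinuous_hist hf ht.le))
    (φ := fun z => (z.2, z.1.2.1, ψ z.1.2)) (by fun_prop)

end ThompsonSampling

namespace ThompsonSampling

variable {O X A Ω : Type*} [MetricSpace O] [MeasurableSpace O] [BorelSpace O] [MeasurableSpace X]
  [MeasurableSpace A] [MeasurableSpace Ω] {Φ : ContextualBandit O X A} {ψ : X × O → A} {T : ℕ}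
  {P : Measure Ω} [IsProbabilityMeasure P] {μ : Measure ℝ} [SigmaFinite μ]
  {f : X × A × O → ℝ → ℝ} {C : ℕ → ℝ × X × A → ℝ≥0}

/-- The Lipschitz bound holds almost surely between the random parameter and a fixed one. -/
lemma IsLipschitzLogLikelihood.ae_param {S : ThompsonSampling Φ ψ T P}
    (hC : S.IsLipschitzLogLikelihood f C) (hf : Φ.IsLikelihood μ f) {t : ℕ} (ht : t < T) (θ' : O) :
    ∀ᵐ ω ∂P, 0 < f (S.ctx t ω, S.act t ω, S.param ω) (S.rew t ω) ∧
      0 < f (S.ctx t ω, S.act t ω, θ') (S.rew t ω) ∧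
      |Real.log (f (S.ctx t ω, S.act t ω, S.param ω) (S.rew t ω)) -
          Real.log (f (S.ctx t ω, S.act t ω, θ') (S.rew t ω))| ≤
        C t (S.rew t ω, S.ctx t ω, S.act t ω) * dist (S.param ω) θ' := by
  have := Φ.isProbabilityMeasure_prior
  have hCm := hC.1 t ht
  have hfm := hf.1
  have hf1 : Measurable fun z : O × ℝ × X × A => f (z.2.2.1, z.2.2.2, z.1) z.2.1 :=
    hfm.comp (by fun_prop : Measurable fun z : O × ℝ × X × A =>
      ((z.2.2.1, z.2.2.2, z.1), z.2.1))
  have hf2 : Measurable fun z : O × ℝ × X × A => f (z.2.2.1, z.2.2.2, θ') z.2.1 :=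
    hfm.comp (by fun_prop : Measurable fun z : O × ℝ × X × A =>
      ((z.2.2.1, z.2.2.2, θ'), z.2.1))
  -- Fixing `θ'` makes the distance a continuous function of one variable, so Borel measurability
  -- needs no separability of `O`.
  have hd : Measurable fun θ : O => dist θ θ' := (continuous_id.dist continuous_const).measurable
  have hs : MeasurableSet {z : O × ℝ × X × A | 0 < f (z.2.2.1, z.2.2.2, z.1) z.2.1 ∧
      0 < f (z.2.2.1, z.2.2.2, θ') z.2.1 ∧
      |Real.log (f (z.2.2.1, z.2.2.2, z.1) z.2.1) - Real.log (f (z.2.2.1, z.2.2.2, θ') z.2.1)| ≤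
        C t z.2 * dist z.1 θ'} := by
    have hl : Measurable fun z : O × ℝ × X × A => |Real.log (f (z.2.2.1, z.2.2.2, z.1) z.2.1) -
        Real.log (f (z.2.2.1, z.2.2.2, θ') z.2.1)| := (hf1.log.sub hf2.log).norm
    have hr : Measurable fun z : O × ℝ × X × A => (C t z.2 : ℝ) * dist z.1 θ' :=
      (measurable_coe_nnreal_real.comp (hCm.comp measurable_snd)).mul (hd.comp measurable_fst)
    exact (measurableSet_lt measurable_const hf1).inter
      ((measurableSet_lt measurable_const hf2).inter (measurableSet_le hl hr))
  exact ae_mem_of_forall_ae_mem S.measurable_param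
    ((S.measurable_rew t).prodMk ((S.measurable_ctx t).prodMk (S.measurable_act t)))
    (S.absolutelyContinuous_round hf ht) hs fun θ => hC.2 t ht θ θ'

end ThompsonSampling

/-! ### Conditional laws of the parameter and of the reward within a round. -/

namespace ProbabilityTheory

/-- A variable which given `(Θ, W)` has a conditional law that does not depend on `Θ` does not
change the conditional law of `Θ`. -/
lemma HasCondDistrib.adjoin_condIndep {Ω O 𝓦 𝓨 : Type*} [MeasurableSpace Ω] [MeasurableSpace O]
    [MeasurableSpace 𝓦] [MeasurableSpace 𝓨] {P : Measure Ω} [IsProbabilityMeasure P] {Θ : Ω → O}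
    {W : Ω → 𝓦} {Y : Ω → 𝓨} {π : Kernel 𝓦 O} [IsMarkovKernel π] {η : Kernel 𝓦 𝓨}
    [IsMarkovKernel η] (hΘ : HasCondDistrib Θ W π P)
    (hY : HasCondDistrib Y (fun ω => (Θ ω, W ω)) (η.comap Prod.snd (by fun_prop)) P) :
    HasCondDistrib Θ (fun ω => (W ω, Y ω)) (π.comap Prod.fst (by fun_prop)) P := by
  have hΘm := hΘ.aemeasurable_snd
  have hW := hΘ.aemeasurable_fst
  have hYm := hY.aemeasurable_snd
  have hWY : P.map (fun ω => (W ω, Y ω)) = P.map W ⊗ₘ η := hY.comp_right.map_eq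
  have hPW : IsProbabilityMeasure (P.map W) := Measure.isProbabilityMeasure_map hW
  refine ⟨by fun_prop, ?_⟩
  have e : P.map (fun ω => ((W ω, Y ω), Θ ω)) =
      (P.map fun ω => ((Θ ω, W ω), Y ω)).map fun z => ((z.1.2, z.2), z.1.1) := by
    rw [AEMeasurable.map_map_of_aemeasurable (by fun_prop) (by fun_prop)]
    rfl
  have e' : P.map (fun ω => (Θ ω, W ω)) = (P.map fun ω => (W ω, Θ ω)).map Prod.swap := by
    rw [AEMeasurable.map_map_of_aemeasurable (by fun_prop) (by fun_prop)]
    rfl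
  rw [e, hY.map_eq, hWY]
  refine Measure.ext_of_lintegral _ fun g hgm => ?_
  have hψ : Measurable fun z : (O × 𝓦) × 𝓨 => ((z.1.2, z.2), z.1.1) := by fun_prop
  have hgψ : Measurable fun z : (O × 𝓦) × 𝓨 => g ((z.1.2, z.2), z.1.1) := hgm.comp hψ
  rw [lintegral_map hgm hψ, Measure.lintegral_compProd hgψ, e']
  have hm1 : Measurable fun z : O × 𝓦 => ∫⁻ y, g ((z.2, y), z.1)
      ∂(η.comap Prod.snd (by fun_prop)) z :=
    hgψ.lintegral_kernel_prod_right'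
  have hm2 : Measurable fun z : 𝓦 × 𝓨 => ∫⁻ θ, g (z, θ) ∂(π.comap Prod.fst (by fun_prop)) z :=
    hgm.lintegral_kernel_prod_right'
  have hm3 : Measurable fun z : 𝓦 × O => ∫⁻ y, g ((z.swap.2, y), z.swap.1)
      ∂(η.comap Prod.snd (by fun_prop)) z.swap := hm1.comp measurable_swap
  rw [lintegral_map hm1 measurable_swap, hΘ.map_eq,
    Measure.lintegral_compProd hm3, Measure.lintegral_compProd hgm,
    Measure.lintegral_compProd hm2]
  -- Given `w`, the two sides are the iterated integrals against `π w` and `η w` in the two orders.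
  refine lintegral_congr fun w => ?_
  have hgw : Measurable fun z : O × 𝓨 => g ((w, z.2), z.1) := hgm.comp (by fun_prop)
  exact lintegral_lintegral_swap (μ := π w) (ν := η w) (f := fun θ y => g ((w, y), θ))
    hgw.aemeasurable

end ProbabilityTheory

namespace ThompsonSampling

variable {O X A Ω : Type*} [MeasurableSpace O] [MeasurableSpace X] [MeasurableSpace A]
  [MeasurableSpace Ω] {Φ : ContextualBandit O X A} {ψ : X × O → A} {T : ℕ} {P : Measure Ω}
  [IsProbabilityMeasure P]

/-- Neither the context nor the sampled parameter carries information on `Θ` beyond the history, so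
the posterior is unchanged by conditioning on them, hence also by conditioning on the action
computed from them. -/
lemma hasCondDistrib_param (S : ThompsonSampling Φ ψ T P) {t : ℕ} (ht : t < T) :
    HasCondDistrib S.param (fun ω => (S.hist t ω, S.ctx t ω, S.act t ω))
      ((S.posterior t).comap (fun z : History X A t × X × A => z.1) (by fun_prop)) P := by
  have := Φ.isProbabilityMeasure_context
  have := S.isMarkovKernel_posterior t
  have hψ := S.measurable_rule
  have h1 := (S.hasCondDistrib_posterior t ht).adjoin_condIndep
    (η := Kernel.const _ Φ.context) (S.hasCondDistrib_ctx t ht)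
  have h2 := h1.adjoin_condIndep
    (η := (S.posterior t).comap (fun z : History X A t × X => z.1) (by fun_prop))
    (S.hasCondDistrib_est t ht)
  exact h2.comp_right
    (κ := (S.posterior t).comap (fun z : History X A t × X × A => z.1) (by fun_prop))
    (f := fun z : (History X A t × X) × O => (z.1.1, z.1.2, ψ (z.1.2, z.2))) (hf := by fun_prop)

/-- The reward kernel sees the sampled parameter only through the action, so conditioning on the
action suffices. -/
lemma hasCondDistrib_rew_prodMk (S : ThompsonSampling Φ ψ T P) {t : ℕ} (ht : t < T) :
    HasCondDistrib (S.rew t) (fun ω => ((S.hist t ω, S.ctx t ω, S.act t ω), S.param ω))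
      (Φ.reward.comap (fun z : (History X A t × X × A) × O => (z.1.2.1, z.1.2.2, z.2))
        (by fun_prop)) P := by
  have := Φ.isMarkovKernel_reward
  have hψ := S.measurable_rule
  exact (S.hasCondDistrib_rew t ht).comp_right
    (κ := Φ.reward.comap (fun z : (History X A t × X × A) × O => (z.1.2.1, z.1.2.2, z.2))
        (by fun_prop))
    (f := fun z : O × History X A t × X × O => ((z.2.1, z.2.2.1, ψ z.2.2), z.1))
    (hf := by fun_prop)

/-- The same kernel with the tuple bracketed as in `rewardDivergence`. -/
lemma hasCondDistrib_rew_act (S : ThompsonSampling Φ ψ T P) {t : ℕ} (ht : t < T) :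
    HasCondDistrib (S.rew t) (fun ω => (S.hist t ω, S.ctx t ω, S.act t ω, S.param ω))
      (Φ.reward.comap (fun z : History X A t × X × A × O => z.2) (by fun_prop)) P := by
  have := Φ.isMarkovKernel_reward
  have hψ := S.measurable_rule
  exact (S.hasCondDistrib_rew t ht).comp_right
    (κ := Φ.reward.comap (fun z : History X A t × X × A × O => z.2) (by fun_prop))
    (f := fun z : O × History X A t × X × O => (z.2.1, z.2.2.1, ψ z.2.2, z.1))
    (hf := by fun_prop)

lemma lintegral_rewardDivergence_le (S : ThompsonSampling Φ ψ T P) {μ : Measure ℝ} [SigmaFinite μ]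
    {f : X × A × O → ℝ → ℝ} (hf : Φ.IsLikelihood μ f) {t : ℕ} (ht : t < T)
    {q : History X A t × X × A → ℝ → ℝ≥0∞} (hq : Measurable (Function.uncurry q))
    (hq1 : ∀ z, ∫⁻ r, q z r ∂μ ≤ 1)
    (hqpos : ∀ᵐ ω ∂P, q (S.hist t ω, S.ctx t ω, S.act t ω) (S.rew t ω) ≠ 0)
    (hfpos : ∀ᵐ ω ∂P, 0 < f (S.ctx t ω, S.act t ω, S.param ω) (S.rew t ω))
    (hint : Integrable (fun ω => Real.log (f (S.ctx t ω, S.act t ω, S.param ω) (S.rew t ω)) -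
      Real.log (q (S.hist t ω, S.ctx t ω, S.act t ω) (S.rew t ω)).toReal) P) :
    ∫⁻ ω, S.rewardDivergence t ω ∂P ≤
      ENNReal.ofReal (∫ ω, Real.log (f (S.ctx t ω, S.act t ω, S.param ω) (S.rew t ω)) -
        Real.log (q (S.hist t ω, S.ctx t ω, S.act t ω) (S.rew t ω)).toReal ∂P) ∧
    0 ≤ ∫ ω, Real.log (f (S.ctx t ω, S.act t ω, S.param ω) (S.rew t ω)) -
        Real.log (q (S.hist t ω, S.ctx t ω, S.act t ω) (S.rew t ω)).toReal ∂P := by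
  have := Φ.isMarkovKernel_reward
  have := S.isMarkovKernel_posterior t
  have hfm := hf.1
  have hp : Measurable (Function.uncurry fun (y : (History X A t × X × A) × O) (r : ℝ) =>
      ENNReal.ofReal (f (y.1.2.1, y.1.2.2, y.2) r)) :=
    (hfm.comp (by fun_prop : Measurable fun y : ((History X A t × X × A) × O) × ℝ =>
      ((y.1.1.2.1, y.1.1.2.2, y.1.2), y.2))).ennreal_ofReal
  have hcongr : (fun ω => Real.log (ENNReal.ofReal
      (f (S.ctx t ω, S.act t ω, S.param ω) (S.rew t ω))).toReal -
      Real.log (q (S.hist t ω, S.ctx t ω, S.act t ω) (S.rew t ω)).toReal) =ᵐ[P]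
      fun ω => Real.log (f (S.ctx t ω, S.act t ω, S.param ω) (S.rew t ω)) -
      Real.log (q (S.hist t ω, S.ctx t ω, S.act t ω) (S.rew t ω)).toReal := by
    filter_upwards [hfpos] with ω hω
    rw [ENNReal.toReal_ofReal hω.le]
  have key := lintegral_klDiv_condDistrib_le hp (fun y => by rw [Kernel.comap_apply, hf.2])
    (S.hasCondDistrib_param ht) (S.hasCondDistrib_rew_prodMk ht) hq hq1 hqpos
    (hint.congr hcongr.symm)
  rw [integral_congr_ae hcongr] at key
  refine ⟨le_trans (le_of_eq (lintegral_congr_ae ?_)) key.1, key.2⟩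
  filter_upwards [(S.hasCondDistrib_rew_prodMk ht).condDistrib_comp_ae_eq,
    (S.hasCondDistrib_rew_act ht).condDistrib_comp_ae_eq] with ω h1 h2
  rw [rewardDivergence, h1, h2]
  rfl

end ThompsonSampling

/-! ### Bayesian prediction with the uniform prior on a finite net. -/

/-- A weighted average of values at log-distance at most `K` from `b` is at log-distance at most
`K` from `b`. -/
lemma Real.abs_log_sub_log_weighted_average_le {ι : Type*} {N : Finset ι} (hN : N.Nonempty)
    {w l : ι → ℝ} {b K : ℝ} (hw : ∀ i ∈ N, 0 < w i) (hl : ∀ i ∈ N, 0 < l i) (hb : 0 < b)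
    (h : ∀ i ∈ N, |Real.log b - Real.log (l i)| ≤ K) :
    |Real.log b - (Real.log (∑ i ∈ N, w i * l i) - Real.log (∑ i ∈ N, w i))| ≤ K := by
  have hW : 0 < ∑ i ∈ N, w i := sum_pos hw hN
  have hWl : 0 < ∑ i ∈ N, w i * l i := sum_pos (fun i hi => mul_pos (hw i hi) (hl i hi)) hN
  have hup : ∑ i ∈ N, w i * l i ≤ (∑ i ∈ N, w i) * (b * Real.exp K) := by
    rw [sum_mul]
    refine sum_le_sum fun i hi => mul_le_mul_of_nonneg_left ?_ (hw i hi).le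
    rw [← Real.log_le_log_iff (hl i hi) (by positivity), Real.log_mul hb.ne' (by positivity),
      Real.log_exp]
    have := (abs_le.1 (h i hi)).1
    linarith
  have hlo : (∑ i ∈ N, w i) * (b * Real.exp (-K)) ≤ ∑ i ∈ N, w i * l i := by
    rw [sum_mul]
    refine sum_le_sum fun i hi => mul_le_mul_of_nonneg_left ?_ (hw i hi).le
    rw [← Real.log_le_log_iff (by positivity) (hl i hi), Real.log_mul hb.ne' (by positivity),
      Real.log_exp]
    have := (abs_le.1 (h i hi)).2
    linarith
  have h1 := Real.log_le_log hWl hup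
  have h2 := Real.log_le_log (by positivity) hlo
  rw [Real.log_mul hW.ne' (by positivity), Real.log_mul hb.ne' (by positivity), Real.log_exp]
    at h1 h2
  rw [abs_le]
  constructor <;> linarith

section NetPrediction

variable {O X A : Type*} [MeasurableSpace O] [MeasurableSpace X] [MeasurableSpace A]

/-- The likelihood of a history under the parameter `θ`. -/
noncomputable def historyLikelihood (f : X × A × O → ℝ → ℝ) {t : ℕ} (h : History X A t) (θ : O) :
    ℝ≥0∞ :=
  ∏ i, ENNReal.ofReal (f ((h i).2.1, (h i).1, θ) (h i).2.2)

/-- The predictive density of the next reward under the uniform prior on the finite set `N`. -/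
noncomputable def netPrediction (f : X × A × O → ℝ → ℝ) (N : Finset O) {t : ℕ}
    (z : History X A t × X × A) (r : ℝ) : ℝ≥0∞ :=
  (∑ θ ∈ N, historyLikelihood f z.1 θ * ENNReal.ofReal (f (z.2.1, z.2.2, θ) r)) /
    ∑ θ ∈ N, historyLikelihood f z.1 θ

variable {f : X × A × O → ℝ → ℝ}

lemma measurable_historyLikelihood (hf : Measurable fun p : (X × A × O) × ℝ => f p.1 p.2) {t : ℕ}
    (θ : O) : Measurable fun h : History X A t => historyLikelihood f h θ := by
  refine Finset.measurable_prod _ fun i _ => ?_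
  exact (hf.comp (by fun_prop : Measurable fun h : History X A t =>
    (((h i).2.1, (h i).1, θ), (h i).2.2))).ennreal_ofReal

lemma measurable_netPrediction (hf : Measurable fun p : (X × A × O) × ℝ => f p.1 p.2)
    (N : Finset O) {t : ℕ} :
    Measurable (Function.uncurry (netPrediction f N (t := t))) := by
  have h1 : ∀ θ, Measurable fun y : (History X A t × X × A) × ℝ => historyLikelihood f y.1.1 θ :=
    fun θ => (measurable_historyLikelihood hf θ).comp (by fun_prop)
  have h2 : ∀ θ, Measurable fun y : (History X A t × X × A) × ℝ =>
      ENNReal.ofReal (f (y.1.2.1, y.1.2.2, θ) y.2) := fun θ =>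
    (hf.comp (by fun_prop : Measurable fun y : (History X A t × X × A) × ℝ =>
      ((y.1.2.1, y.1.2.2, θ), y.2))).ennreal_ofReal
  exact (Finset.measurable_sum _ fun θ _ => (h1 θ).mul (h2 θ)).div
    (Finset.measurable_sum _ fun θ _ => h1 θ)

/-- Only an inequality, because the prediction is zero when every parameter in `N` gives the history
zero likelihood. -/
lemma lintegral_netPrediction_le {Φ : ContextualBandit O X A} {μ : Measure ℝ}
    (hf : Φ.IsLikelihood μ f) (N : Finset O) {t : ℕ} (z : History X A t × X × A) :
    ∫⁻ r, netPrediction f N z r ∂μ ≤ 1 := by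
  have := Φ.isMarkovKernel_reward
  have hm : ∀ θ, Measurable fun r => ENNReal.ofReal (f (z.2.1, z.2.2, θ) r) := fun θ =>
    (hf.1.comp (by fun_prop : Measurable fun r : ℝ =>
      ((z.2.1, z.2.2, θ), r))).ennreal_ofReal
  have h1 : ∀ θ, ∫⁻ r, ENNReal.ofReal (f (z.2.1, z.2.2, θ) r) ∂μ = 1 := fun θ => by
    have : Φ.reward (z.2.1, z.2.2, θ) Set.univ = 1 := measure_univ
    rwa [hf.2, withDensity_apply _ MeasurableSet.univ, setLIntegral_univ] at this
  simp only [netPrediction, div_eq_mul_inv]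
  rw [lintegral_mul_const _ (Finset.measurable_sum _ fun θ _ => (hm θ).const_mul _),
    lintegral_finsetSum _ fun θ _ => (hm θ).const_mul _]
  simp_rw [lintegral_const_mul _ (hm _), h1, mul_one]
  exact ENNReal.mul_inv_le_one _

end NetPrediction

namespace ThompsonSampling

variable {O X A Ω : Type*} [MeasurableSpace O] [MeasurableSpace X]
  [MeasurableSpace A] [MeasurableSpace Ω] {Φ : ContextualBandit O X A} {ψ : X × O → A} {T : ℕ}
  {P : Measure Ω}

/-- The likelihood of the reward of round `t` under the parameter `θ`. -/
noncomputable def rewardLikelihood (S : ThompsonSampling Φ ψ T P) (f : X × A × O → ℝ → ℝ) (t : ℕ)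
    (ω : Ω) (θ : O) : ℝ :=
  f (S.ctx t ω, S.act t ω, θ) (S.rew t ω)

/-- The total likelihood of the first `t` rewards under the parameters in `N`. -/
noncomputable def netLikelihood (S : ThompsonSampling Φ ψ T P) (f : X × A × O → ℝ → ℝ)
    (N : Finset O) (t : ℕ) (ω : Ω) : ℝ :=
  ∑ θ ∈ N, ∏ s ∈ range t, S.rewardLikelihood f s ω θ

variable {S : ThompsonSampling Φ ψ T P} {f : X × A × O → ℝ → ℝ} {N : Finset O} {t : ℕ} {ω : Ω}

lemma historyLikelihood_hist (hpos : ∀ s < t, ∀ θ ∈ N, 0 < S.rewardLikelihood f s ω θ) {θ : O}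
    (hθ : θ ∈ N) : historyLikelihood f (S.hist t ω) θ =
      ENNReal.ofReal (∏ s ∈ range t, S.rewardLikelihood f s ω θ) := by
  rw [ENNReal.ofReal_prod_of_nonneg fun s hs => (hpos s (mem_range.1 hs) θ hθ).le,
    ← Fin.prod_univ_eq_prod_range (fun s => ENNReal.ofReal (S.rewardLikelihood f s ω θ))]
  rfl

lemma measurable_rewardLikelihood_param (S : ThompsonSampling Φ ψ T P)
    (hf : Measurable fun p : (X × A × O) × ℝ => f p.1 p.2) (t : ℕ) :
    Measurable fun ω => S.rewardLikelihood f t ω (S.param ω) := by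
  have h : Measurable fun ω => ((S.ctx t ω, S.act t ω, S.param ω), S.rew t ω) :=
    ((S.measurable_ctx t).prodMk ((S.measurable_act t).prodMk S.measurable_param)).prodMk
      (S.measurable_rew t)
  exact hf.comp h

lemma measurable_netPrediction_rew (S : ThompsonSampling Φ ψ T P)
    (hf : Measurable fun p : (X × A × O) × ℝ => f p.1 p.2) (N : Finset O) (t : ℕ) :
    Measurable fun ω => netPrediction f N (S.hist t ω, S.ctx t ω, S.act t ω) (S.rew t ω) := by
  have h : Measurable fun ω => ((S.hist t ω, S.ctx t ω, S.act t ω), S.rew t ω) :=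
    ((S.measurable_hist t).prodMk ((S.measurable_ctx t).prodMk (S.measurable_act t))).prodMk
      (S.measurable_rew t)
  have h' := (measurable_netPrediction hf N (t := t)).comp h
  simpa only [Function.comp_def, Function.uncurry_apply_pair] using h'

lemma netLikelihood_pos (hN : N.Nonempty)
    (hpos : ∀ s < t, ∀ θ ∈ N, 0 < S.rewardLikelihood f s ω θ) : 0 < S.netLikelihood f N t ω :=
  sum_pos (fun θ hθ => prod_pos fun s hs => hpos s (mem_range.1 hs) θ hθ) hN

/-- The form that makes the cumulative log loss telescope. -/
lemma netPrediction_eq (hN : N.Nonempty)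
    (hpos : ∀ s < t + 1, ∀ θ ∈ N, 0 < S.rewardLikelihood f s ω θ) :
    netPrediction f N (S.hist t ω, S.ctx t ω, S.act t ω) (S.rew t ω) =
      ENNReal.ofReal (S.netLikelihood f N (t + 1) ω / S.netLikelihood f N t ω) := by
  have hpos' : ∀ s < t, ∀ θ ∈ N, 0 < S.rewardLikelihood f s ω θ := fun s hs =>
    hpos s (hs.trans (Nat.lt_succ_self t))
  have hprod : ∀ θ ∈ N, 0 ≤ ∏ s ∈ range t, S.rewardLikelihood f s ω θ := fun θ hθ =>
    (prod_pos fun s hs => hpos' s (mem_range.1 hs) θ hθ).le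
  rw [ENNReal.ofReal_div_of_pos (netLikelihood_pos hN hpos'), netPrediction]
  congr 1
  · rw [netLikelihood, ENNReal.ofReal_sum_of_nonneg fun θ hθ =>
      (prod_pos fun s hs => hpos s (mem_range.1 hs) θ hθ).le]
    refine sum_congr rfl fun θ hθ => ?_
    rw [prod_range_succ, ENNReal.ofReal_mul (hprod θ hθ), historyLikelihood_hist hpos' hθ]
    rfl
  · rw [netLikelihood, ENNReal.ofReal_sum_of_nonneg hprod]
    exact sum_congr rfl fun θ hθ => historyLikelihood_hist hpos' hθ

end ThompsonSampling

/-! ### The cumulative information bound at a fixed scale. -/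

namespace ThompsonSampling

variable {O X A Ω : Type*} [MetricSpace O] [MeasurableSpace O] [BorelSpace O] [MeasurableSpace X]
  [MeasurableSpace A] [MeasurableSpace Ω] {Φ : ContextualBandit O X A} {ψ : X × O → A} {T : ℕ}
  {P : Measure Ω} [IsProbabilityMeasure P] {μ : Measure ℝ} [SigmaFinite μ]
  {f : X × A × O → ℝ → ℝ} {C : ℕ → ℝ × X × A → ℝ≥0}

/-- The cumulative information about the parameter is at most the logarithm of the size of an
`ε`-net plus the cumulative fluctuation of the log-likelihood at scale `ε`. -/
theorem sum_lintegral_rewardDivergence_le (S : ThompsonSampling Φ ψ T P)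
    (hf : Φ.IsLikelihood μ f) (hC : S.IsLipschitzLogLikelihood f C) {N : Finset O}
    (hN : N.Nonempty) {ε : ℝ≥0} (hcover : ∀ θ, ∃ θ' ∈ N, dist θ θ' ≤ ε)
    (hCfin : ∀ t < T, ∫⁻ ω, (C t (S.rew t ω, S.ctx t ω, S.act t ω) : ℝ≥0∞) ∂P ≠ ∞) :
    ∑ t ∈ range T, ∫⁻ ω, S.rewardDivergence t ω ∂P ≤
      ε * (∑ t ∈ range T, ∫⁻ ω, (C t (S.rew t ω, S.ctx t ω, S.act t ω) : ℝ≥0∞) ∂P) +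
        ENNReal.ofReal (Real.log #N) := by
  set c : ℕ → Ω → ℝ≥0 := fun t ω => C t (S.rew t ω, S.ctx t ω, S.act t ω) with hc
  have hcm : ∀ t < T, Measurable (c t) := fun t ht => (hC.1 t ht).comp
    ((S.measurable_rew t).prodMk ((S.measurable_ctx t).prodMk (S.measurable_act t)))
  set ℓ : ℕ → Ω → O → ℝ := S.rewardLikelihood f with hℓ
  set Λ : ℕ → Ω → ℝ := S.netLikelihood f N with hΛ
  -- A crude finite bound on the distance from any parameter to any net point. It serves only to
  -- make the log-likelihood ratios integrable and does not enter the final estimate.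
  set D : ℝ := ε + ∑ a ∈ N, ∑ b ∈ N, dist a b with hD
  have hDle : ∀ θ, ∀ b ∈ N, dist θ b ≤ D := fun θ b hb => by
    obtain ⟨a, ha, hεa⟩ := hcover θ
    have h1 : dist a b ≤ ∑ b ∈ N, dist a b :=
      single_le_sum (f := fun b => dist a b) (fun _ _ => dist_nonneg) hb
    have h2 : ∑ b ∈ N, dist a b ≤ ∑ a ∈ N, ∑ b ∈ N, dist a b :=
      single_le_sum (f := fun a => ∑ b ∈ N, dist a b)
        (fun _ _ => sum_nonneg fun _ _ => dist_nonneg) ha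
    linarith [dist_triangle θ a b]
  have hae : ∀ᵐ ω ∂P, ∀ t < T, ∀ θ ∈ N, 0 < ℓ t ω (S.param ω) ∧ 0 < ℓ t ω θ ∧
      |Real.log (ℓ t ω (S.param ω)) - Real.log (ℓ t ω θ)| ≤ c t ω * dist (S.param ω) θ := by
    refine ae_all_iff.2 fun t => ?_
    by_cases ht : t < T
    · have : ∀ᵐ ω ∂P, ∀ θ ∈ (N : Set O), 0 < ℓ t ω (S.param ω) ∧ 0 < ℓ t ω θ ∧
        |Real.log (ℓ t ω (S.param ω)) - Real.log (ℓ t ω θ)| ≤ c t ω * dist (S.param ω) θ :=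
        (ae_ball_iff N.countable_toSet).2 fun θ _ => hC.ae_param hf ht θ
      filter_upwards [this] with ω h _ using h
    · exact .of_forall fun ω h => absurd h ht
  set g : ℕ → Ω → ℝ := fun t ω => Real.log (ℓ t ω (S.param ω)) -
    Real.log (netPrediction f N (S.hist t ω, S.ctx t ω, S.act t ω) (S.rew t ω)).toReal with hg
  have hgeq : ∀ᵐ ω ∂P, ∀ t < T, g t ω = Real.log (ℓ t ω (S.param ω)) -
      (Real.log (Λ (t + 1) ω) - Real.log (Λ t ω)) := by
    filter_upwards [hae] with ω h t ht
    have hpos : ∀ s < t + 1, ∀ θ ∈ N, 0 < S.rewardLikelihood f s ω θ := fun s hs θ hθ =>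
      (h s (by omega) θ hθ).2.1
    have h1 := netLikelihood_pos hN hpos
    have h2 := netLikelihood_pos (t := t) hN fun s hs => hpos s (by omega)
    simp only [hg]
    rw [netPrediction_eq hN hpos, ENNReal.toReal_ofReal (by positivity),
      Real.log_div h1.ne' h2.ne']
  have hgbound : ∀ t < T, ∀ᵐ ω ∂P, ‖g t ω‖ ≤ c t ω * D := fun t ht => by
    filter_upwards [hae, hgeq] with ω h h'
    rw [h' t ht, Real.norm_eq_abs]
    -- The prediction is an average of the likelihoods of the round, weighted by the likelihoods of
    -- the past, so its logarithm is within `c t ω * D` of the true one.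
    have e : Λ (t + 1) ω = ∑ θ ∈ N, (∏ s ∈ range t, ℓ s ω θ) * ℓ t ω θ := by
      simp only [hΛ, netLikelihood, prod_range_succ, hℓ]
    rw [e]
    obtain ⟨a, ha⟩ := hN
    refine Real.abs_log_sub_log_weighted_average_le ⟨a, ha⟩
      (fun θ hθ => prod_pos fun s hs => (h s ((mem_range.1 hs).trans ht) θ hθ).2.1)
      (fun θ hθ => (h t ht θ hθ).2.1) (h t ht a ha).1 fun θ hθ => ?_
    exact (h t ht θ hθ).2.2.trans (mul_le_mul_of_nonneg_left (hDle _ θ hθ) (c t ω).coe_nonneg)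
  have hci : ∀ t < T, Integrable (fun ω => (c t ω : ℝ)) P := fun t ht => by
    refine ⟨(measurable_coe_nnreal_real.comp (hcm t ht)).aestronglyMeasurable, ?_⟩
    rw [hasFiniteIntegral_iff_enorm]
    simpa using (hCfin t ht).lt_top
  have hgm : ∀ t, Measurable (g t) := fun t => by
    have h1 := S.measurable_rewardLikelihood_param hf.1 t
    have h2 := S.measurable_netPrediction_rew hf.1 N t
    exact h1.log.sub h2.ennreal_toReal.log
  have hgi : ∀ t < T, Integrable (g t) P := fun t ht =>
    ((hci t ht).mul_const D).mono' (hgm t).aestronglyMeasurable (hgbound t ht)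
  have hround : ∀ t ∈ range T, ∫⁻ ω, S.rewardDivergence t ω ∂P ≤ ENNReal.ofReal (∫ ω, g t ω ∂P) ∧
      0 ≤ ∫ ω, g t ω ∂P := fun t ht => by
    have ht := mem_range.1 ht
    obtain ⟨a, ha⟩ := hN
    refine S.lintegral_rewardDivergence_le hf ht (measurable_netPrediction hf.1 N)
      (lintegral_netPrediction_le hf N) ?_ (hae.mono fun ω h => (h t ht a ha).1) (hgi t ht)
    filter_upwards [hae] with ω h
    have hpos : ∀ s < t + 1, ∀ θ ∈ N, 0 < S.rewardLikelihood f s ω θ := fun s hs θ hθ =>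
      (h s (by omega) θ hθ).2.1
    have h1 := netLikelihood_pos ⟨a, ha⟩ hpos
    have h2 := netLikelihood_pos (t := t) ⟨a, ha⟩ fun s hs => hpos s (by omega)
    rw [netPrediction_eq ⟨a, ha⟩ hpos]
    exact (ENNReal.ofReal_pos.2 (div_pos h1 h2)).ne'
  have hsum : ∀ᵐ ω ∂P, ∑ t ∈ range T, g t ω ≤ ε * ∑ t ∈ range T, (c t ω : ℝ) + Real.log #N := by
    filter_upwards [hae, hgeq] with ω h h'
    -- The net point depends on `ω`, which is harmless: `Λ T ω` dominates each of its summands.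
    obtain ⟨a, ha, hεa⟩ := hcover (S.param ω)
    rw [sum_congr rfl fun t ht => h' t (mem_range.1 ht), sum_sub_distrib,
      sum_range_sub (fun t => Real.log (Λ t ω))]
    -- Empty products: the initial total likelihood is the size of the net, the source of `log #N`.
    have e0 : Λ 0 ω = #N := by simp [hΛ, netLikelihood]
    have hT : ∑ t ∈ range T, Real.log (ℓ t ω a) ≤ Real.log (Λ T ω) := by
      rw [← Real.log_prod fun t ht => (h t (mem_range.1 ht) a ha).2.1.ne']
      refine Real.log_le_log (prod_pos fun t ht => (h t (mem_range.1 ht) a ha).2.1) ?_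
      exact single_le_sum (f := fun θ => ∏ t ∈ range T, ℓ t ω θ)
        (fun θ hθ => prod_nonneg fun t ht => (h t (mem_range.1 ht) θ hθ).2.1.le) ha
    have hl : ∑ t ∈ range T, Real.log (ℓ t ω (S.param ω)) ≤
        ∑ t ∈ range T, Real.log (ℓ t ω a) + ε * ∑ t ∈ range T, (c t ω : ℝ) := by
      rw [mul_sum, ← sum_add_distrib]
      refine sum_le_sum fun t ht => ?_
      have h1 := (abs_le.1 (h t (mem_range.1 ht) a ha).2.2).2
      have h2 := mul_le_mul_of_nonneg_left hεa (c t ω).coe_nonneg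
      linarith
    rw [e0]
    linarith
  have hcsum : Integrable (fun ω => ε * ∑ t ∈ range T, (c t ω : ℝ)) P :=
    (integrable_finsetSum _ fun t ht => hci t (mem_range.1 ht)).const_mul _
  have hint : ∑ t ∈ range T, ∫ ω, g t ω ∂P ≤
      ε * ∑ t ∈ range T, ∫ ω, (c t ω : ℝ) ∂P + Real.log #N := by
    rw [← integral_finsetSum _ fun t ht => hgi t (mem_range.1 ht),
      ← integral_finsetSum _ fun t ht => hci t (mem_range.1 ht), ← integral_const_mul]
    calc _ ≤ ∫ ω, (ε * ∑ t ∈ range T, (c t ω : ℝ) + Real.log #N) ∂P :=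
          integral_mono_ae (integrable_finsetSum _ fun t ht => hgi t (mem_range.1 ht))
            (hcsum.add (integrable_const _)) hsum
      _ = _ := by rw [integral_add hcsum (integrable_const _)]; simp
  have hclint : ∀ t ∈ range T, ∫⁻ ω, (c t ω : ℝ≥0∞) ∂P = ENNReal.ofReal (∫ ω, (c t ω : ℝ) ∂P) :=
    fun t ht => by
      rw [ofReal_integral_eq_lintegral_ofReal (hci t (mem_range.1 ht))
        (.of_forall fun ω => (c t ω).coe_nonneg)]
      simp
  have hc0 : ∀ t ∈ range T, 0 ≤ ∫ ω, (c t ω : ℝ) ∂P := fun t _ =>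
    integral_nonneg fun ω => (c t ω).coe_nonneg
  calc ∑ t ∈ range T, ∫⁻ ω, S.rewardDivergence t ω ∂P
      ≤ ∑ t ∈ range T, ENNReal.ofReal (∫ ω, g t ω ∂P) := sum_le_sum fun t ht => (hround t ht).1
    _ = ENNReal.ofReal (∑ t ∈ range T, ∫ ω, g t ω ∂P) :=
        (ENNReal.ofReal_sum_of_nonneg fun t ht => (hround t ht).2).symm
    _ ≤ ENNReal.ofReal (ε * ∑ t ∈ range T, ∫ ω, (c t ω : ℝ) ∂P + Real.log #N) :=
        ENNReal.ofReal_le_ofReal hint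
    _ = _ := by
        rw [ENNReal.ofReal_add (mul_nonneg ε.coe_nonneg (sum_nonneg hc0)) (Real.log_natCast_nonneg _),
          ENNReal.ofReal_mul ε.coe_nonneg, ENNReal.ofReal_sum_of_nonneg hc0, ENNReal.ofReal_coe_nnreal,
          sum_congr rfl hclint]

end ThompsonSampling

/-! ### Covering numbers and the infimum over scales. -/

lemma logCoveringNumber_of_eq_coe {O : Type*} [MetricSpace O] {ε : ℝ≥0} {n : ℕ} (hn : n ≠ 0)
    (h : Metric.coveringNumber ε (Set.univ : Set O) = n) :
    logCoveringNumber O ε = ENNReal.ofReal (Real.log n) := by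
  have hn' : (0 : ℝ) < n := by exact_mod_cast Nat.pos_of_ne_zero hn
  rw [logCoveringNumber, h, ENat.toENNReal_coe, ← ENNReal.ofReal_natCast,
    ENNReal.log_ofReal_of_pos hn', EReal.real_coe_toENNReal]

/-- A finite covering number is attained by a finite net. -/
lemma exists_finset_net_of_logCoveringNumber_ne_top {O : Type*} [MetricSpace O] [Nonempty O]
    {ε : ℝ≥0} (h : logCoveringNumber O ε ≠ ∞) :
    ∃ N : Finset O, N.Nonempty ∧ (∀ θ, ∃ θ' ∈ N, dist θ θ' ≤ ε) ∧
      logCoveringNumber O ε = ENNReal.ofReal (Real.log #N) := by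
  have h' : Metric.coveringNumber ε (Set.univ : Set O) ≠ ⊤ := fun e => h (by
    simp [logCoveringNumber, e])
  obtain ⟨N, -, hfin, hcov, hcard⟩ := Metric.exists_set_encard_eq_coveringNumber h'
  obtain ⟨N, rfl⟩ := hfin.exists_finset_coe
  have hne : N.Nonempty := by simpa using hcov.nonempty Set.univ_nonempty
  refine ⟨N, hne, fun θ => ?_, ?_⟩
  · obtain ⟨θ', hθ', hd⟩ := hcov (Set.mem_univ θ)
    refine ⟨θ', hθ', ?_⟩
    have hd' : edist θ θ' ≤ ε := hd
    rwa [edist_nndist, ENNReal.coe_le_coe] at hd'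
  · rw [Set.encard_coe_eq_coe_finsetCard] at hcard
    exact logCoveringNumber_of_eq_coe (card_pos.2 hne).ne' hcard.symm

namespace ThompsonSampling

section

variable {O X A Ω : Type*} [MetricSpace O] [MeasurableSpace O] [BorelSpace O] [MeasurableSpace X]
  [MeasurableSpace A] [MeasurableSpace Ω] {Φ : ContextualBandit O X A} {ψ : X × O → A} {T : ℕ}
  {P : Measure Ω} [IsProbabilityMeasure P] {μ : Measure ℝ} [SigmaFinite μ]
  {f : X × A × O → ℝ → ℝ} {C : ℕ → ℝ × X × A → ℝ≥0}

lemma sum_lintegral_rewardDivergence_le_iInf (S : ThompsonSampling Φ ψ T P) (hT : T ≠ 0)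
    (hf : Φ.IsLikelihood μ f) (hC : S.IsLipschitzLogLikelihood f C) :
    ∑ t ∈ range T, ∫⁻ ω, S.rewardDivergence t ω ∂P ≤
      ⨅ (ε : ℝ≥0) (_ : 0 < ε),
        ((ε : ℝ≥0∞) * S.meanLipschitzConst C * T + logCoveringNumber O ε) := by
  have := Φ.isProbabilityMeasure_prior
  have hO : Nonempty O := Φ.prior.nonempty_of_neZero
  refine le_iInf₂ fun ε hε => ?_
  have hT' : (T : ℝ≥0∞) ≠ 0 := by exact_mod_cast hT
  have e : (ε : ℝ≥0∞) * S.meanLipschitzConst C * T =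
      ε * ∑ t ∈ range T, ∫⁻ ω, (C t (S.rew t ω, S.ctx t ω, S.act t ω) : ℝ≥0∞) ∂P := by
    rw [mul_assoc, meanLipschitzConst, ENNReal.div_mul_cancel hT' (ENNReal.natCast_ne_top T)]
  rw [e]
  by_cases hcov : logCoveringNumber O ε = ∞
  · simp [hcov]
  -- If the total Lipschitz constant is infinite, `ε > 0` makes the bound infinite; with `ε = 0` the
  -- product would be zero.
  by_cases hCfin : ∑ t ∈ range T, ∫⁻ ω, (C t (S.rew t ω, S.ctx t ω, S.act t ω) : ℝ≥0∞) ∂P = ∞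
  · rw [hCfin, ENNReal.mul_top (by exact_mod_cast hε.ne'), top_add]
    exact le_top
  obtain ⟨N, hN, hnet, hlog⟩ := exists_finset_net_of_logCoveringNumber_ne_top hcov
  rw [hlog]
  exact S.sum_lintegral_rewardDivergence_le hf hC hN hnet fun t ht =>
    (ENNReal.sum_ne_top.1 hCfin) t (mem_range.2 ht)

end

/-! ### From information to regret. -/

variable {O X A Ω : Type*} [MeasurableSpace O] [MeasurableSpace X] [MeasurableSpace A]
  [MeasurableSpace Ω] {Φ : ContextualBandit O X A} {ψ : X × O → A} {T : ℕ} {P : Measure Ω}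

lemma sigmaHistCtx_le (S : ThompsonSampling Φ ψ T P) (t : ℕ) :
    S.sigmaHistCtx t ≤ (inferInstance : MeasurableSpace Ω) :=
  ((S.measurable_hist t).prodMk (S.measurable_ctx t)).comap_le

variable [IsProbabilityMeasure P]

/-- Context and parameter are independent with the prescribed laws. This ties the run to
`ruleRewardLaw`, from which integrability and mean of the optimal rewards follow. -/
lemma map_optRew (S : ThompsonSampling Φ ψ T P) {t : ℕ} (ht : t < T) :
    P.map (S.optRew t) = Φ.ruleRewardLaw ψ := by
  have := Φ.isProbabilityMeasure_prior
  have := Φ.isProbabilityMeasure_context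
  have := Φ.isMarkovKernel_reward
  have hψ := S.measurable_rule
  have hΘ := S.measurable_param
  have hX := S.measurable_ctx t
  have h1 := (S.hasCondDistrib_ctx t ht).comp_right (κ := Kernel.const O Φ.context)
    (f := Prod.fst) (hf := measurable_fst)
  have h2 : P.map (fun ω => (S.ctx t ω, S.param ω)) = Φ.context.prod Φ.prior := by
    have h3 : P.map (fun ω => (S.param ω, S.ctx t ω)) = Φ.prior.prod Φ.context := by
      have h4 := h1.map_eq
      rw [Measure.compProd_const] at h4
      have h5 : P.map (Prod.fst ∘ fun ω => (S.param ω, S.hist t ω)) = Φ.prior :=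
        S.hasLaw_param.map_eq
      exact h4.trans (by rw [← h5]; rfl)
    rw [← Measure.prod_swap, ← h3, Measure.map_map measurable_swap (by fun_prop)]
    rfl
  have h6 := (S.hasCondDistrib_optRew t ht).comp_right
    (κ := Φ.reward.comap (fun p : X × O => (p.1, ψ p, p.2)) (by fun_prop))
    (f := fun z : O × History X A t × X => (z.2.2, z.1)) (hf := by fun_prop)
  have h7 : P.map (fun ω => ((S.ctx t ω, S.param ω), S.optRew t ω)) =
      (Φ.context.prod Φ.prior) ⊗ₘ
        Φ.reward.comap (fun p : X × O => (p.1, ψ p, p.2)) (by fun_prop) := by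
    rw [← h2]; exact h6.map_eq
  rw [← Measure.snd_map_prodMk (X := fun ω => (S.ctx t ω, S.param ω)) (by fun_prop), h7,
    Measure.snd_compProd]
  rfl

lemma integrable_optRew (S : ThompsonSampling Φ ψ T P) (hψ : Φ.IsAdmissibleRule ψ) {t : ℕ}
    (ht : t < T) : Integrable (S.optRew t) P := by
  have h := hψ.2
  rw [← S.map_optRew ht] at h
  exact (integrable_map_measure aestronglyMeasurable_id (S.measurable_optRew t).aemeasurable).1 h

lemma integral_optRew (S : ThompsonSampling Φ ψ T P) {t : ℕ} (ht : t < T) :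
    ∫ ω, S.optRew t ω ∂P = ∫ r, r ∂(Φ.ruleRewardLaw ψ) := by
  rw [← S.map_optRew ht]
  exact (integral_map (S.measurable_optRew t).aemeasurable aestronglyMeasurable_id).symm

lemma _root_.ContextualBandit.IsOptimalRule.optimalReward_eq (hψ : Φ.IsOptimalRule T ψ) :
    Φ.optimalReward T = Φ.ruleReward T ψ :=
  IsGreatest.csSup_eq ⟨⟨ψ, hψ.1, rfl⟩, by rintro _ ⟨ψ', h, rfl⟩; exact hψ.2 ψ' h⟩

lemma regret_eq_sum (S : ThompsonSampling Φ ψ T P) (hψ : Φ.IsOptimalRule T ψ)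
    (hR : ∀ t < T, Integrable (S.rew t) P) :
    S.regret = ∑ t ∈ range T, ∫ ω, (S.optRew t ω - S.rew t ω) ∂P := by
  rw [regret, hψ.optimalReward_eq, integral_finsetSum _ fun t ht => hR t (mem_range.1 ht),
    ContextualBandit.ruleReward, ← sum_sub_distrib]
  refine sum_congr rfl fun t ht => ?_
  have ht := mem_range.1 ht
  rw [integral_sub (S.integrable_optRew hψ.1 ht) (hR t ht), S.integral_optRew ht]

/-- The tower property. -/
lemma lintegral_condInfo (S : ThompsonSampling Φ ψ T P) (t : ℕ) :
    ∫⁻ ω, S.condInfo t ω ∂P = ∫⁻ ω, S.rewardDivergence t ω ∂P :=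
  lintegral_condLExp (S.sigmaHistCtx_le t) P _

lemma measurable_condInfo (S : ThompsonSampling Φ ψ T P) (t : ℕ) : Measurable (S.condInfo t) :=
  (measurable_condLExp _ _ _).mono (S.sigmaHistCtx_le t) le_rfl

lemma measurable_liftedInfoRatio (S : ThompsonSampling Φ ψ T P) (t : ℕ) :
    Measurable (S.liftedInfoRatio t) := by
  have h : Measurable (condExp (S.sigmaHistCtx t) P fun ω' => S.optRew t ω' - S.rew t ω') :=
    stronglyMeasurable_condExp.measurable.mono (S.sigmaHistCtx_le t) le_rfl
  exact (h.pow_const 2).ennreal_ofReal.div (S.measurable_condInfo t)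

/-- The expected regret of a round is controlled by the information ratio and the information
gain. -/
lemma ofReal_integral_optRew_sub_rew_le (S : ThompsonSampling Φ ψ T P) {t : ℕ}
    (hratio : ∫⁻ ω, S.liftedInfoRatio t ω ∂P ≠ ∞) (hinfo : ∫⁻ ω, S.rewardDivergence t ω ∂P ≠ ∞) :
    ENNReal.ofReal (∫ ω, (S.optRew t ω - S.rew t ω) ∂P) ≤
      (∫⁻ ω, S.liftedInfoRatio t ω ∂P) ^ (1 / 2 : ℝ) *
        (∫⁻ ω, S.rewardDivergence t ω ∂P) ^ (1 / 2 : ℝ) := by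
  set Δ := condExp (S.sigmaHistCtx t) P fun ω => S.optRew t ω - S.rew t ω with hΔ
  have hI := S.measurable_condInfo t
  have hΓ := S.measurable_liftedInfoRatio t
  have hbound : ∀ᵐ ω ∂P, ‖Δ ω‖ₑ ≤
      S.liftedInfoRatio t ω ^ (1 / 2 : ℝ) * S.condInfo t ω ^ (1 / 2 : ℝ) := by
    filter_upwards [ae_lt_top hΓ hratio, ae_lt_top hI (by rwa [lintegral_condInfo])] with ω h1 h2
    have h3 : ENNReal.ofReal (Δ ω ^ 2) ≤ S.liftedInfoRatio t ω * S.condInfo t ω := by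
      -- Where the information vanishes, finiteness of the ratio forces zero conditional regret, by
      -- the convention `a / 0 = ∞`.
      rcases eq_or_ne (S.condInfo t ω) 0 with h0 | h0
      · have h4 : ENNReal.ofReal (Δ ω ^ 2) = 0 := by
          by_contra hne
          rw [liftedInfoRatio, h0, ENNReal.div_zero hne] at h1
          exact lt_irrefl _ h1
        rw [h4]
        exact zero_le
      · rw [liftedInfoRatio, ENNReal.div_mul_cancel h0 h2.ne]
    rw [← ENNReal.mul_rpow_of_nonneg _ _ (by norm_num)]
    calc ‖Δ ω‖ₑ = ENNReal.ofReal |Δ ω| := Real.enorm_eq_ofReal_abs _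
      _ = ENNReal.ofReal (Δ ω ^ 2) ^ (1 / 2 : ℝ) := by
          rw [ENNReal.ofReal_rpow_of_nonneg (sq_nonneg _) (by norm_num), ← Real.sqrt_eq_rpow,
            Real.sqrt_sq_eq_abs]
      _ ≤ _ := ENNReal.rpow_le_rpow h3 (by norm_num)
  have hint : ∫ ω, (S.optRew t ω - S.rew t ω) ∂P = ∫ ω, Δ ω ∂P :=
    (integral_condExp (S.sigmaHistCtx_le t)).symm
  rw [hint, ← S.lintegral_condInfo t]
  calc ENNReal.ofReal (∫ ω, Δ ω ∂P) ≤ ‖∫ ω, Δ ω ∂P‖ₑ := by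
        rw [Real.enorm_eq_ofReal_abs]; exact ENNReal.ofReal_le_ofReal (le_abs_self _)
    _ ≤ ∫⁻ ω, ‖Δ ω‖ₑ ∂P := enorm_integral_le_lintegral_enorm _
    _ ≤ ∫⁻ ω, S.liftedInfoRatio t ω ^ (1 / 2 : ℝ) * S.condInfo t ω ^ (1 / 2 : ℝ) ∂P :=
        lintegral_mono_ae hbound
    _ ≤ _ := ENNReal.lintegral_mul_norm_pow_le hΓ.aemeasurable hI.aemeasurable (by norm_num)
        (by norm_num) (by norm_num)

/-- The regret is controlled by the total information ratio and the total information gain. -/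
lemma ofReal_regret_le (S : ThompsonSampling Φ ψ T P) (hψ : Φ.IsOptimalRule T ψ)
    (hR : ∀ t < T, Integrable (S.rew t) P)
    (hratio : ∑ t ∈ range T, ∫⁻ ω, S.liftedInfoRatio t ω ∂P ≠ ∞)
    (hinfo : ∑ t ∈ range T, ∫⁻ ω, S.rewardDivergence t ω ∂P ≠ ∞) :
    ENNReal.ofReal S.regret ≤
      ((∑ t ∈ range T, ∫⁻ ω, S.liftedInfoRatio t ω ∂P) *
        ∑ t ∈ range T, ∫⁻ ω, S.rewardDivergence t ω ∂P) ^ (1 / 2 : ℝ) := by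
  rw [S.regret_eq_sum hψ hR, ENNReal.mul_rpow_of_nonneg _ _ (by norm_num)]
  have hpow : ∀ x : ℝ≥0∞, (x ^ (1 / 2 : ℝ)) ^ (2 : ℝ) = x := fun x => by
    rw [← ENNReal.rpow_mul]; norm_num
  calc ENNReal.ofReal (∑ t ∈ range T, ∫ ω, (S.optRew t ω - S.rew t ω) ∂P)
      ≤ ∑ t ∈ range T, ENNReal.ofReal (∫ ω, (S.optRew t ω - S.rew t ω) ∂P) :=
        le_sum_of_subadditive ENNReal.ofReal (by simp) (fun _ _ => ENNReal.ofReal_add_le) _ _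
    _ ≤ ∑ t ∈ range T, (∫⁻ ω, S.liftedInfoRatio t ω ∂P) ^ (1 / 2 : ℝ) *
        (∫⁻ ω, S.rewardDivergence t ω ∂P) ^ (1 / 2 : ℝ) := sum_le_sum fun t ht =>
        S.ofReal_integral_optRew_sub_rew_le (ENNReal.sum_ne_top.1 hratio t ht)
          (ENNReal.sum_ne_top.1 hinfo t ht)
    _ ≤ _ := by
        refine (ENNReal.inner_le_Lp_mul_Lq _ _ _ Real.HolderConjugate.two_two).trans_eq ?_
        simp_rw [hpow]

end ThompsonSampling

theorem theorem2 {O X A Ω : Type*} [MetricSpace O] [MeasurableSpace O] [BorelSpace O]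
    [MeasurableSpace X] [MeasurableSpace A] [MeasurableSpace Ω]
    (Φ : ContextualBandit O X A) (T : ℕ) (ψ : X × O → A) (hψ : Φ.IsOptimalRule T ψ)
    (P : Measure Ω) [IsProbabilityMeasure P] (S : ThompsonSampling Φ ψ T P)
    (hR : ∀ t < T, Integrable (S.rew t) P)
    (μ : Measure ℝ) [SigmaFinite μ] (f : X × A × O → ℝ → ℝ) (hf : Φ.IsLikelihood μ f)
    (C : ℕ → ℝ × X × A → ℝ≥0) (hC : S.IsLipschitzLogLikelihood f C)
    (Γ : ℝ) (hΓ : 0 < Γ)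
    (hratio : (∑ t ∈ range T, ∫⁻ ω, S.liftedInfoRatio t ω ∂P) / T ≤ ENNReal.ofReal Γ) :
    ((S.regret : ℝ) : EReal) ≤
      (((ENNReal.ofReal Γ * T *
        ⨅ (ε : ℝ≥0) (_ : 0 < ε),
          ((ε : ℝ≥0∞) * S.meanLipschitzConst C * T + logCoveringNumber O ε)) ^ (1 / 2 : ℝ) :
        ℝ≥0∞) : EReal) := by
  -- Without rounds the averages divide by zero, but the regret is zero.
  rcases eq_or_ne T 0 with rfl | hT
  · have h0 : S.regret = 0 := by rw [S.regret_eq_sum hψ hR]; simp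
    rw [h0]
    exact EReal.coe_ennreal_nonneg _
  have hT' : (T : ℝ≥0∞) ≠ 0 := by exact_mod_cast hT
  have hΓT : ENNReal.ofReal Γ * T ≠ 0 := mul_ne_zero (ENNReal.ofReal_pos.2 hΓ).ne' hT'
  have hsum : ∑ t ∈ range T, ∫⁻ ω, S.liftedInfoRatio t ω ∂P ≤ ENNReal.ofReal Γ * T :=
    (ENNReal.div_le_iff hT' (ENNReal.natCast_ne_top T)).1 hratio
  have hinfo := S.sum_lintegral_rewardDivergence_le_iInf hT hf hC
  set B := ⨅ (ε : ℝ≥0) (_ : 0 < ε),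
    ((ε : ℝ≥0∞) * S.meanLipschitzConst C * T + logCoveringNumber O ε)
  -- Here `Γ > 0` matters: it makes the right-hand side infinite when `B` is.
  rcases eq_or_ne B ∞ with hB | hB
  · rw [hB, ENNReal.mul_top hΓT, ENNReal.top_rpow_of_pos (by norm_num), EReal.coe_ennreal_top]
    exact le_top
  have hreg := S.ofReal_regret_le hψ hR
    (hsum.trans_lt (ENNReal.mul_lt_top ENNReal.ofReal_lt_top (ENNReal.natCast_lt_top T))).ne
    (hinfo.trans_lt hB.lt_top).ne
  -- Truncating a possibly negative regret at zero only increases it.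
  calc ((S.regret : ℝ) : EReal) ≤ ((ENNReal.ofReal S.regret : ℝ≥0∞) : EReal) := by
        rw [EReal.coe_ennreal_ofReal]
        exact EReal.coe_le_coe_iff.2 (le_max_left _ _)
    _ ≤ _ := EReal.coe_ennreal_le_coe_ennreal_iff.2
        (hreg.trans (ENNReal.rpow_le_rpow (mul_le_mul' hsum hinfo) (by norm_num)))
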